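/- Work in ZFC, with $V$ the universe of sets. For a transitive class $N$ and $X \subseteq N$, let $H^N(X)$ be the class of all elements of $N$ that are first-order definable in $(N,\in)$ from parameters in $X$. An elementary embedding $j : M \to N$ between transitive classes (inner models) is an \emph{ultrapower embedding} of $M$ if $N = H^N(j[M]\cup\{x\})$ for some $x \in N$; it is an \emph{internal ultrapower embedding} of $M$ if moreover $j\restriction x \in M$ for all $x \in M$. The \emph{Ultrapower Axiom} (UA) states that for all ultrapower embeddings $j_0 : V\to M_0$ and $j_1 : V \to M_1$ there are a transitive class $N$ and internal ultrapower embeddings $i_0 : M_0\to N$ of $M_0$ and $i_1 : M_1 \to N$ of $M_1$ such that $i_0\circ j_0 = i_1\circ j_1$. An ordinal $\alpha$ is \emph{tail uniform} if there is a countably complete ultrafilter $U$ on $\alpha$ such that $\alpha\setminus\beta\in U$ for all $\beta<\alpha$. Let $\delta$ be an (infinite) regular cardinal. An elementary embedding $j : V \to M$ into a transitive class is a \emph{Ketonen embedding} at $\delta$ if, with $\delta_* = \sup j[\delta]$, $M = H^M(j[V]\cup\{\delta_*\})$ and $\delta_*$ is not tail uniform in $M$. An ultrapower embedding $j : V\to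 M$ is \emph{zero order} at $\delta$ if $\sup j[\delta]$ is not tail uniform in $M$. \textbf{Theorem.} Assume UA and let $\delta$ be a regular cardinal. (1) If $j : V\to M$ is a Ketonen embedding at $\delta$ and $j' : V\to M'$ is an ultrapower embedding that is zero order at $\delta$, then there is an internal ultrapower embedding $k : M\to M'$ of $M$ such that $j' = k\circ j$. (2) There is exactly one Ketonen embedding $j : V \to M$ at $\delta$ (existence, and uniqueness of both $M$ and $j$). -/

import Mathlib

/-!
Set theory is done inside Mathlib's model `ZFSet.{u}` of ZFC, which plays the role of the universe
`V`; classes are arbitrary subsets of `ZFSet.{u}`.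
-/

universe u

namespace UltraAx

/-- The only non-logical symbol of the language of set theory: a binary relation symbol. -/
inductive SetRel : ℕ → Type
  | mem : SetRel 2

/-- The first-order language of set theory. -/
def setLang : FirstOrder.Language.{0, 0} where
  Functions := fun _ => Empty
  Relations := SetRel

/-- A transitive class of sets. -/
@[ext]
structure TransClass : Type (u + 1) where
  carrier : Set ZFSet.{u}
  transitive' : ∀ x ∈ carrier, ∀ y ∈ x, y ∈ carrier

instance : SetLike TransClass.{u} ZFSet.{u} where
  coe := TransClass.carrier
  coe_injective := fun _ _ h => TransClass.ext h

/-- A transitive class, viewed as the structure `(M, ∈)`. -/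
instance (M : TransClass.{u}) : setLang.Structure M where
  funMap := fun f => nomatch f
  RelMap := fun {_} r => match r with
    | SetRel.mem => fun x => (x 0 : ZFSet.{u}) ∈ (x 1 : ZFSet.{u})

/-- The universe `V` of all sets. -/
def V : TransClass.{u} where
  carrier := Set.univ
  transitive' := fun _ _ _ _ => trivial

/-- Elementary embeddings `j : (M, ∈) → (N, ∈)` between transitive classes. -/
abbrev Emb (M N : TransClass.{u}) : Type (u + 1) := setLang.ElementaryEmbedding M N

/-- `H^N(X)`: the class of all elements of `N` that are first-order definable in `(N, ∈)` from
parameters in `X`. -/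
def hull (N : TransClass.{u}) (X : Set N) : Set N :=
  {y | X.Definable₁ setLang {y}}

/-- `j : M → N` is an ultrapower embedding of `M`: `N = H^N(j[M] ∪ {x})` for some `x ∈ N`. -/
def IsUltrapower {M N : TransClass.{u}} (j : Emb M N) : Prop :=
  ∃ x : N, hull N (Set.range j ∪ {x}) = Set.univ

/-- `j : M → N` is an internal ultrapower embedding of `M`: it is an ultrapower embedding of `M`,
and for every set `x ∈ M` the restriction `j ↾ x`, a set of ordered pairs, belongs to `M`. -/
def IsInternalUltrapower {M N : TransClass.{u}} (j : Emb M N) : Prop :=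
  IsUltrapower j ∧
    ∀ x : M, ∃ g : M, ∀ z : ZFSet.{u},
      z ∈ (g : ZFSet.{u}) ↔
        ∃ a : M, (a : ZFSet.{u}) ∈ (x : ZFSet.{u}) ∧ z = ZFSet.pair (a : ZFSet.{u}) (j a)

/-- The Ultrapower Axiom: for every pair of ultrapower embeddings `j₀ : V → M₀`, `j₁ : V → M₁` there
is a comparison, that is, a pair of internal ultrapower embeddings `i₀ : M₀ → N`, `i₁ : M₁ → N` into
one transitive class such that `i₀ ∘ j₀ = i₁ ∘ j₁`. -/
def UltrapowerAxiom : Prop :=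
  ∀ (M₀ M₁ : TransClass.{u}) (j₀ : Emb V M₀) (j₁ : Emb V M₁),
    IsUltrapower j₀ → IsUltrapower j₁ →
      ∃ (N : TransClass.{u}) (i₀ : Emb M₀ N) (i₁ : Emb M₁ N),
        IsInternalUltrapower i₀ ∧ IsInternalUltrapower i₁ ∧ i₀.comp j₀ = i₁.comp j₁

/-- For an ordinal `α ∈ M`, this says that `M` satisfies "`U` is a tail uniform countably complete
ultrafilter on `α`": all quantifiers over sets and over `ω`-sequences are relativized to `M`. -/
structure IsUniformUltrafilterIn (M : TransClass.{u}) (α U : ZFSet.{u}) : Prop where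
  mem_model : U ∈ M
  subset : ∀ A ∈ U, A ⊆ α
  empty_notMem : ∅ ∉ U
  top_mem : α ∈ U
  superset : ∀ A ∈ U, ∀ B ∈ M, A ⊆ B → B ⊆ α → B ∈ U
  inter : ∀ A ∈ U, ∀ B ∈ U, A ∩ B ∈ U
  ultra : ∀ A ∈ M, A ⊆ α → A ∈ U ∨ α \ A ∈ U
  tail : ∀ β ∈ α, α \ β ∈ U
  countablyComplete : ∀ f ∈ M, ZFSet.IsFunc ZFSet.omega U f →
    ZFSet.sep (fun x => ∀ n A : ZFSet.{u}, ZFSet.pair n A ∈ f → x ∈ A) α ∈ U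

/-- The ordinal `α ∈ M` is tail uniform in `M`: in `M`, it carries a tail uniform countably complete
ultrafilter. -/
def IsTailUniformIn (M : TransClass.{u}) (α : ZFSet.{u}) : Prop :=
  ∃ U : ZFSet.{u}, IsUniformUltrafilterIn M α U

/-- `sup j[δ]`, the union of the ordinals `j(α)`, `α < δ`. -/
noncomputable def supImage {M : TransClass.{u}} (j : Emb V M) (δ : Cardinal.{u}) : ZFSet.{u} :=
  ZFSet.iUnion fun α : Set.Iio δ.ord =>
    (j ⟨(α : Ordinal.{u}).toZFSet, trivial⟩ : ZFSet.{u})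

/-- `j : V → M` is a Ketonen embedding at `δ`: for `δ_* = sup j[δ]`, which is an element of `M`,
`M = H^M(j[V] ∪ {δ_*})` and `δ_*` is not tail uniform in `M`. -/
def IsKetonen {M : TransClass.{u}} (j : Emb V M) (δ : Cardinal.{u}) : Prop :=
  hull M (Set.range j ∪ {y : M | (y : ZFSet.{u}) = supImage j δ}) = Set.univ ∧
    ¬ IsTailUniformIn M (supImage j δ)

/-- `j : V → M` is a zero order ultrapower embedding at `δ`. -/
def IsZeroOrder {M : TransClass.{u}} (j : Emb V M) (δ : Cardinal.{u}) : Prop :=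
  IsUltrapower j ∧ ¬ IsTailUniformIn M (supImage j δ)

end UltraAx

/-!
# Ketonen embeddings under the Ultrapower Axiom

**Factorization.** Let `j : V → M` be a Ketonen embedding at `δ` and `j' : V → M'` a zero order
ultrapower embedding, and let `i : M → N`, `i' : M' → N` be the comparison given by the Ultrapower
Axiom. If `i` were discontinuous at `δ_* = sup j[δ]`, the ultrafilter derived from `i` and
`sup i[δ_*]` would belong to `M`, as `i` is internal, and would show that `δ_*` is tail uniform in
`M` (`mem_emb_iff_of_not_tailUniform`). So `i` is continuous at `δ_*`, likewise `i'` at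
`δ'_* = sup j'[δ]`, and both `i δ_*` and `i' δ'_*` are the supremum of `(i ∘ j)[δ]`. Since `M` is
generated by `δ_*` over the range of `j`, it follows that `i[M] ⊆ i'[M']`, and `k = i'⁻¹ ∘ i` is an
elementary embedding with `k ∘ j = j'` and `k δ_* = δ'_*` (`IsKetonen.exists_factor`). It is internal
because on a set it is the composition of `i` with a Mostowski collapse that can be computed in `M`
(`isInternal_of_comp`).

**Uniqueness.** For two Ketonen embeddings the factors in the two directions fix the generators, so
they are inverse to each other, and isomorphic transitive classes are equal (`IsKetonen.unique`).

**Existence.** This part needs no Ultrapower Axiom. The Ketonen order on countably complete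
ultrafilters is well-founded (`wellFounded_ketonenLT`), so there is a minimal `U` among the countably
complete ultrafilters on `δ + 1` that contain all tails of `δ`. Its ultrapower is a Ketonen embedding:
if the identity represented an ordinal above `δ_*`, or if `δ_*` were tail uniform in the ultrapower,
then an ultrafilter below `U` would arise (`exists_isKetonen`).

All uses of elementarity go through the predicate `FODef`, which says that a relation given for all
transitive classes is defined in all of them by a single formula.
-/

namespace UltraAx

open FirstOrder FirstOrder.Language Filter

/-! ### Uniformly first-order relations -/

/-- A relation on tuples of elements of transitive classes, given for all transitive classes at
once, is uniformly first order if a single formula of the language of set theory defines it in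
every transitive class. The tuples are indexed by an arbitrary type `α` of variables. -/
def FODef {α : Type*} (P : ∀ N : TransClass.{u}, (α → N) → Prop) : Prop :=
  ∃ φ : setLang.Formula α, ∀ (N : TransClass.{u}) (v : α → N), φ.Realize v ↔ P N v

namespace FODef

variable {α : Type*} {P Q : ∀ N : TransClass.{u}, (α → N) → Prop}

theorem congr (h : FODef P) (e : ∀ N v, P N v ↔ Q N v) : FODef Q := by
  obtain ⟨φ, hφ⟩ := h
  exact ⟨φ, fun N v => (hφ N v).trans (e N v)⟩

theorem not (h : FODef P) : FODef fun N v => ¬ P N v := by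
  obtain ⟨φ, hφ⟩ := h
  exact ⟨φ.not, fun N v => by simp [hφ]⟩

theorem imp (h : FODef P) (h' : FODef Q) : FODef fun N v => P N v → Q N v := by
  obtain ⟨φ, hφ⟩ := h
  obtain ⟨ψ, hψ⟩ := h'
  exact ⟨φ.imp ψ, fun N v => by simp [hφ, hψ]⟩

theorem and (h : FODef P) (h' : FODef Q) : FODef fun N v => P N v ∧ Q N v := by
  obtain ⟨φ, hφ⟩ := h
  obtain ⟨ψ, hψ⟩ := h'
  exact ⟨φ ⊓ ψ, fun N v => by simp [hφ, hψ]⟩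

theorem or (h : FODef P) (h' : FODef Q) : FODef fun N v => P N v ∨ Q N v := by
  obtain ⟨φ, hφ⟩ := h
  obtain ⟨ψ, hψ⟩ := h'
  exact ⟨φ ⊔ ψ, fun N v => by simp [hφ, hψ]⟩

theorem iff (h : FODef P) (h' : FODef Q) : FODef fun N v => P N v ↔ Q N v :=
  ((h.imp h').and (h'.imp h)).congr fun _ _ => iff_iff_implies_and_implies.symm

/-- Substitution of variables. -/
theorem relabel {β : Type*} (h : FODef P) (g : α → β) :
    FODef fun N (v : β → N) => P N (fun a => v (g a)) := by
  obtain ⟨φ, hφ⟩ := h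
  exact ⟨φ.relabel g, fun N v => by rw [Formula.realize_relabel]; exact hφ N _⟩

theorem all_finite {β : Type*} [Finite β] {R : ∀ N : TransClass.{u}, (α ⊕ β → N) → Prop}
    (h : FODef R) : FODef fun N v => ∀ w : β → N, R N (Sum.elim v w) := by
  obtain ⟨φ, hφ⟩ := h
  exact ⟨φ.iAlls β, fun N v => by rw [Formula.realize_iAlls]; simp only [hφ]⟩

/-- Quantification over the variable `none` of `Option α`; the other variables are those of `α`. -/
theorem all {R : ∀ N : TransClass.{u}, (α → N) → N → Prop}
    (h : FODef fun N (v : Option α → N) => R N (fun a => v (some a)) (v none)) :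
    FODef fun N v => ∀ x : N, R N v x := by
  refine (all_finite (β := Unit) (h.relabel fun o => o.elim (Sum.inr ()) Sum.inl)).congr
    fun N v => ⟨fun H x => H fun _ => x, fun H w => H (w ())⟩

theorem ex {R : ∀ N : TransClass.{u}, (α → N) → N → Prop}
    (h : FODef fun N (v : Option α → N) => R N (fun a => v (some a)) (v none)) :
    FODef fun N v => ∃ x : N, R N v x :=
  (all (R := fun N v x => ¬ R N v x) h.not).not.congr fun N v => by simp

/-- Elementary embeddings preserve uniformly first-order relations. -/
theorem elem (h : FODef P) {M N : TransClass.{u}} (j : Emb M N) (v : α → M) :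
    P N (fun a => j (v a)) ↔ P M v := by
  obtain ⟨φ, hφ⟩ := h
  rw [← hφ, ← hφ]
  exact j.map_formula φ v

/-- A uniformly first-order relation that holds of all tuples of `V` holds of all tuples of every
class into which `V` embeds elementarily. -/
theorem transfer [Finite α] (h : FODef P) {M : TransClass.{u}} (j : Emb V M)
    (hV : ∀ v : α → V.{u}, P V v) (v : α → M) : P M v := by
  have h' : FODef fun N (_ : Empty → N) => ∀ w : α → N, P N w :=
    (all_finite (α := Empty) (h.relabel Sum.inr)).congr fun N v => by rfl
  exact (h'.elem j Empty.elim).2 hV v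

end FODef

/-! ### Absolute relations between sets -/

section Atoms

variable {α : Type*}

theorem fo_mem (a b : α) :
    FODef.{u} fun _ v => (v a : ZFSet.{u}) ∈ (v b : ZFSet.{u}) :=
  ⟨Relations.formula (L := setLang) (n := 2) SetRel.mem ![Term.var a, Term.var b],
    fun _ _ => Formula.realize_rel⟩

theorem fo_eq (a b : α) : FODef.{u} fun _ v => (v a : ZFSet.{u}) = (v b : ZFSet.{u}) :=
  ⟨Term.equal (.var a) (.var b), fun _ _ => Formula.realize_equal.trans Subtype.ext_iff⟩

theorem TransClass.mem_of_mem {N : TransClass.{u}} {x y : ZFSet.{u}} (hy : y ∈ N) (h : x ∈ y) :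
    x ∈ N := N.transitive' y hy x h

theorem TransClass.exists_mem_iff {N : TransClass.{u}} (y : N) {p : ZFSet.{u} → Prop} :
    (∃ x : N, (x : ZFSet.{u}) ∈ (y : ZFSet.{u}) ∧ p x) ↔ ∃ x ∈ (y : ZFSet.{u}), p x :=
  ⟨fun ⟨x, h, hp⟩ => ⟨x, h, hp⟩, fun ⟨x, h, hp⟩ => ⟨⟨x, N.mem_of_mem y.2 h⟩, h, hp⟩⟩

theorem TransClass.forall_mem_iff {N : TransClass.{u}} (y : N) {p : ZFSet.{u} → Prop} :
    (∀ x : N, (x : ZFSet.{u}) ∈ (y : ZFSet.{u}) → p x) ↔ ∀ x ∈ (y : ZFSet.{u}), p x :=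
  ⟨fun H x h => H ⟨x, N.mem_of_mem y.2 h⟩ h, fun H x h => H x h⟩

/-- Membership in an element of a transitive class, tested on elements of the class, determines the
element. -/
theorem TransClass.forall_mem_iff_iff {N : TransClass.{u}} (x : N) (y : ZFSet.{u})
    (hy : ∀ z ∈ y, z ∈ N) {p : N → Prop} (hp : ∀ z : N, p z ↔ (z : ZFSet.{u}) ∈ y) :
    (∀ z : N, (z : ZFSet.{u}) ∈ (x : ZFSet.{u}) ↔ p z) ↔ (x : ZFSet.{u}) = y := by
  refine ⟨fun h => ZFSet.ext fun z => ⟨fun hz => ?_, fun hz => ?_⟩, fun h z => by rw [hp, h]⟩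
  · exact (hp _).1 ((h ⟨z, N.mem_of_mem x.2 hz⟩).1 hz)
  · exact (h ⟨z, hy z hz⟩).2 ((hp _).2 hz)

theorem fo_subset (a b : α) :
    FODef.{u} fun _ v => (v a : ZFSet.{u}) ⊆ (v b : ZFSet.{u}) :=
  FODef.congr (P := fun N v => ∀ x : N, (x : ZFSet.{u}) ∈ (v a : ZFSet.{u}) →
      (x : ZFSet.{u}) ∈ (v b : ZFSet.{u}))
    (.all (.imp (fo_mem _ _) (fo_mem _ _)))
    fun N v => N.forall_mem_iff (v a) (p := fun x => x ∈ (v b : ZFSet.{u}))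

theorem fo_empty (a : α) : FODef.{u} fun _ v => (v a : ZFSet.{u}) = ∅ :=
  FODef.congr (P := fun N v => ∀ x : N, ¬ (x : ZFSet.{u}) ∈ (v a : ZFSet.{u}))
    (.all (.not (fo_mem _ _))) fun N v => by
      rw [ZFSet.eq_empty]
      exact ⟨fun H y hy => H ⟨y, N.mem_of_mem (v a).2 hy⟩ hy, fun H y => H y⟩

theorem fo_insert (a b c : α) :
    FODef.{u} fun _ v => (v a : ZFSet.{u}) = insert (v b : ZFSet.{u}) (v c : ZFSet.{u}) :=
  FODef.congr (P := fun N v => ∀ x : N, (x : ZFSet.{u}) ∈ (v a : ZFSet.{u}) ↔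
      (x : ZFSet.{u}) = v b ∨ (x : ZFSet.{u}) ∈ (v c : ZFSet.{u}))
    (.all (.iff (fo_mem _ _) (.or (fo_eq _ _) (fo_mem _ _)))) fun N v => by
      refine N.forall_mem_iff_iff (v a) (insert (v b : ZFSet.{u}) (v c : ZFSet.{u})) ?_ ?_
      · intro z hz
        rcases ZFSet.mem_insert_iff.1 hz with rfl | hz
        exacts [(v b).2, N.mem_of_mem (v c).2 hz]
      · simp

theorem fo_singleton (a b : α) :
    FODef.{u} fun _ v => (v a : ZFSet.{u}) = {(v b : ZFSet.{u})} :=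
  FODef.congr (P := fun N v => ∀ x : N, (x : ZFSet.{u}) ∈ (v a : ZFSet.{u}) ↔
      (x : ZFSet.{u}) = v b)
    (.all (.iff (fo_mem _ _) (fo_eq _ _))) fun N v => by
      refine N.forall_mem_iff_iff (v a) {(v b : ZFSet.{u})} ?_ ?_
      · intro z hz
        rw [ZFSet.mem_singleton.1 hz]
        exact (v b).2
      · simp

theorem fo_unordered (a b c : α) :
    FODef.{u} fun _ v => (v a : ZFSet.{u}) = {(v b : ZFSet.{u}), (v c : ZFSet.{u})} :=
  FODef.congr (P := fun N v => ∀ x : N, (x : ZFSet.{u}) ∈ (v a : ZFSet.{u}) ↔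
      (x : ZFSet.{u}) = v b ∨ (x : ZFSet.{u}) = v c)
    (.all (.iff (fo_mem _ _) (.or (fo_eq _ _) (fo_eq _ _)))) fun N v => by
      refine N.forall_mem_iff_iff (v a) {(v b : ZFSet.{u}), (v c : ZFSet.{u})} ?_ ?_
      · intro z hz
        rcases ZFSet.mem_pair.1 hz with rfl | rfl
        exacts [(v b).2, (v c).2]
      · simp

/-- A transitive class that contains an ordered pair also contains the two sets by which the pair is
defined, so the definition can be evaluated inside the class. -/
theorem fo_pair (a b c : α) :
    FODef.{u} fun _ v => (v a : ZFSet.{u}) = ZFSet.pair (v b : ZFSet.{u}) (v c : ZFSet.{u}) :=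
  FODef.congr (P := fun N v => ∃ x y : N, (x : ZFSet.{u}) = {(v b : ZFSet.{u})} ∧
      (y : ZFSet.{u}) = {(v b : ZFSet.{u}), (v c : ZFSet.{u})} ∧
      (v a : ZFSet.{u}) = {(x : ZFSet.{u}), (y : ZFSet.{u})})
    (.ex (.ex (.and (fo_singleton _ _) (.and (fo_unordered _ _ _) (fo_unordered _ _ _)))))
    fun N v => by
      constructor
      · rintro ⟨x, y, hx, hy, h⟩
        rw [h, hx, hy]; rfl
      · intro h
        have hx : ({(v b : ZFSet.{u})} : ZFSet.{u}) ∈ N :=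
          N.mem_of_mem (v a).2 (by rw [h]; simp [ZFSet.pair])
        have hy : ({(v b : ZFSet.{u}), (v c : ZFSet.{u})} : ZFSet.{u}) ∈ N :=
          N.mem_of_mem (v a).2 (by rw [h]; simp [ZFSet.pair])
        exact ⟨⟨_, hx⟩, ⟨_, hy⟩, rfl, rfl, h⟩

theorem fo_pair_mem (a b c : α) :
    FODef.{u} fun _ v => ZFSet.pair (v a : ZFSet.{u}) (v b : ZFSet.{u}) ∈ (v c : ZFSet.{u}) :=
  FODef.congr (P := fun N v => ∃ x : N, (x : ZFSet.{u}) ∈ (v c : ZFSet.{u}) ∧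
      (x : ZFSet.{u}) = ZFSet.pair (v a : ZFSet.{u}) (v b : ZFSet.{u}))
    (.ex (.and (fo_mem _ _) (fo_pair _ _ _))) fun N v =>
    (N.exists_mem_iff (v c) (p := fun x => x = ZFSet.pair _ _)).trans (by simp)

theorem fo_transitive (a : α) : FODef.{u} fun _ v => (v a : ZFSet.{u}).IsTransitive :=
  FODef.congr (P := fun N v => ∀ x : N, (x : ZFSet.{u}) ∈ (v a : ZFSet.{u}) →
      (x : ZFSet.{u}) ⊆ (v a : ZFSet.{u}))
    (.all (.imp (fo_mem _ _) (fo_subset _ _))) fun N v =>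
      N.forall_mem_iff (v a) (p := fun x => x ⊆ (v a : ZFSet.{u}))

theorem fo_ordinal (a : α) : FODef.{u} fun _ v => (v a : ZFSet.{u}).IsOrdinal :=
  FODef.congr (P := fun N v => (v a : ZFSet.{u}).IsTransitive ∧
      ∀ x : N, (x : ZFSet.{u}) ∈ (v a : ZFSet.{u}) → (x : ZFSet.{u}).IsTransitive)
    (.and (fo_transitive _) (.all (.imp (fo_mem _ _) (fo_transitive _)))) fun N v => by
      rw [N.forall_mem_iff (v a) (p := ZFSet.IsTransitive)]
      exact ZFSet.isOrdinal_iff_forall_mem_isTransitive.symm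

end Atoms

theorem TransClass.pair_mem {N : TransClass.{u}} {a b c : ZFSet.{u}} (hc : c ∈ N)
    (h : ZFSet.pair a b ∈ c) : a ∈ N ∧ b ∈ N := by
  have h1 := N.mem_of_mem hc h
  have h2 : ({a, b} : ZFSet.{u}) ∈ N := N.mem_of_mem h1 (by simp [ZFSet.pair])
  exact ⟨N.mem_of_mem h2 (by simp), N.mem_of_mem h2 (by simp)⟩

/-! ### Elementary embeddings of transitive classes -/

section Emb

variable {M N : TransClass.{u}} (j : Emb M N)

theorem emb_mem (a b : M) :
    (j a : ZFSet.{u}) ∈ (j b : ZFSet.{u}) ↔ (a : ZFSet.{u}) ∈ (b : ZFSet.{u}) :=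
  (fo_mem (0 : Fin 2) 1).elem j ![a, b]

theorem emb_subset (a b : M) :
    (j a : ZFSet.{u}) ⊆ (j b : ZFSet.{u}) ↔ (a : ZFSet.{u}) ⊆ (b : ZFSet.{u}) :=
  (fo_subset (0 : Fin 2) 1).elem j ![a, b]

theorem emb_empty (a : M) : (j a : ZFSet.{u}) = ∅ ↔ (a : ZFSet.{u}) = ∅ :=
  (fo_empty (0 : Fin 1)).elem j ![a]

theorem emb_insert (a b c : M) :
    (j a : ZFSet.{u}) = insert (j b : ZFSet.{u}) (j c : ZFSet.{u}) ↔
      (a : ZFSet.{u}) = insert (b : ZFSet.{u}) (c : ZFSet.{u}) :=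
  (fo_insert (0 : Fin 3) 1 2).elem j ![a, b, c]

theorem emb_pair_mem (a b c : M) :
    ZFSet.pair (j a : ZFSet.{u}) (j b) ∈ (j c : ZFSet.{u}) ↔
      ZFSet.pair (a : ZFSet.{u}) b ∈ (c : ZFSet.{u}) :=
  (fo_pair_mem (0 : Fin 3) 1 2).elem j ![a, b, c]

theorem emb_transitive (a : M) : (j a : ZFSet.{u}).IsTransitive ↔ (a : ZFSet.{u}).IsTransitive :=
  (fo_transitive (0 : Fin 1)).elem j ![a]

theorem emb_ordinal (a : M) : (j a : ZFSet.{u}).IsOrdinal ↔ (a : ZFSet.{u}).IsOrdinal :=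
  (fo_ordinal (0 : Fin 1)).elem j ![a]

theorem fo_singleValued {α : Type*} (f : α) :
    FODef.{u} fun N v => ∀ x y z : N, ZFSet.pair (x : ZFSet.{u}) y ∈ (v f : ZFSet.{u}) →
      ZFSet.pair (x : ZFSet.{u}) z ∈ (v f : ZFSet.{u}) → (y : ZFSet.{u}) = z :=
  .all (.all (.all (.imp (fo_pair_mem _ _ _) (.imp (fo_pair_mem _ _ _) (fo_eq _ _)))))

theorem emb_singleValued {f : M} :
    (∀ x y z : N, ZFSet.pair (x : ZFSet.{u}) y ∈ (j f : ZFSet.{u}) →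
      ZFSet.pair (x : ZFSet.{u}) z ∈ (j f : ZFSet.{u}) → (y : ZFSet.{u}) = z) ↔
    ∀ x y z : M, ZFSet.pair (x : ZFSet.{u}) y ∈ (f : ZFSet.{u}) →
      ZFSet.pair (x : ZFSet.{u}) z ∈ (f : ZFSet.{u}) → (y : ZFSet.{u}) = z :=
  (fo_singleValued (0 : Fin 1)).elem j ![f]

theorem mem_omega_iff {x : ZFSet.{u}} :
    x ∈ ZFSet.omega.{u} ↔ ∃ n : ℕ, (n : Ordinal.{u}).toZFSet = x := by
  have key : ∀ n : ℕ, ZFSet.mk (PSet.ofNat.{u} n) = (n : Ordinal.{u}).toZFSet := by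
    intro n
    induction n with
    | zero => simp; rfl
    | succ n ih =>
      rw [Nat.cast_add, Nat.cast_one, Ordinal.toZFSet_add_one, ← ih]
      rfl
  constructor
  · refine Quotient.inductionOn x fun y => ?_
    rintro ⟨⟨n⟩, h⟩
    exact ⟨n, (key n).symm.trans (ZFSet.sound h).symm⟩
  · rintro ⟨n, rfl⟩
    induction n with
    | zero => simp
    | succ n ih =>
      rw [Nat.cast_add, Nat.cast_one, Ordinal.toZFSet_add_one]
      exact ZFSet.omega_succ ih

/-- Elementary embeddings fix the natural numbers. -/
theorem emb_nat {n : M} (hn : (n : ZFSet.{u}) ∈ ZFSet.omega.{u}) : (j n : ZFSet.{u}) = n := by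
  obtain ⟨k, hk⟩ := mem_omega_iff.1 hn
  induction k generalizing n with
  | zero =>
    have : (n : ZFSet.{u}) = ∅ := by rw [← hk]; simp
    rw [this, emb_empty, this]
  | succ k ih =>
    rw [Nat.cast_add, Nat.cast_one, Ordinal.toZFSet_add_one] at hk
    have hm : (k : Ordinal.{u}).toZFSet ∈ M := M.mem_of_mem n.2 (by rw [← hk]; simp)
    have := ih (n := ⟨_, hm⟩) (mem_omega_iff.2 ⟨k, rfl⟩) rfl
    have h2 := (emb_insert j n ⟨_, hm⟩ ⟨_, hm⟩).2 hk.symm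
    rw [h2, this, ← hk]

/-- Elementary embeddings fix `ω`, because every element of `ω` is zero or the successor of an element
of `ω`. -/
theorem emb_omega {w : M} (hw : (w : ZFSet.{u}) = ZFSet.omega) : (j w : ZFSet.{u}) = ZFSet.omega := by
  have fo : FODef.{u} fun N (v : Fin 1 → N) => ∀ x : N, (x : ZFSet.{u}) ∈ (v 0 : ZFSet.{u}) →
      (x : ZFSet.{u}) = ∅ ∨ ∃ y : N, (y : ZFSet.{u}) ∈ (v 0 : ZFSet.{u}) ∧
        (x : ZFSet.{u}) = insert (y : ZFSet.{u}) (y : ZFSet.{u}) :=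
    .all (.imp (fo_mem _ _) (.or (fo_empty _) (.ex (.and (fo_mem _ _) (fo_insert _ _ _)))))
  have hM : ∀ x : M, (x : ZFSet.{u}) ∈ (w : ZFSet.{u}) →
      (x : ZFSet.{u}) = ∅ ∨ ∃ y : M, (y : ZFSet.{u}) ∈ (w : ZFSet.{u}) ∧
        (x : ZFSet.{u}) = insert (y : ZFSet.{u}) (y : ZFSet.{u}) := by
    intro x hx
    rw [hw] at hx
    obtain ⟨k, hk⟩ := mem_omega_iff.1 hx
    cases k with
    | zero => left; rw [← hk]; simp
    | succ k =>
      right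
      rw [Nat.cast_add, Nat.cast_one, Ordinal.toZFSet_add_one] at hk
      exact ⟨⟨_, M.mem_of_mem x.2 (y := (x : ZFSet.{u})) (by rw [← hk]; exact ZFSet.mem_insert _ _)⟩,
        by rw [hw]; exact mem_omega_iff.2 ⟨k, rfl⟩, hk.symm⟩
  have hN := (fo.elem j ![w]).2 hM
  refine ZFSet.ext fun x => ⟨?_, fun hx => ?_⟩
  · refine ZFSet.inductionOn x fun x ih hx => ?_
    rcases hN ⟨x, N.mem_of_mem (j w).2 hx⟩ hx with h | ⟨y, hy, h⟩
    · change x = ∅ at h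
      rw [h]; exact ZFSet.omega_zero
    · change x = insert _ _ at h
      rw [h]
      exact ZFSet.omega_succ (ih _ (by rw [h]; exact ZFSet.mem_insert _ _) hy)
  · have hxw : x ∈ (w : ZFSet.{u}) := by rw [hw]; exact hx
    have := (emb_mem j ⟨x, M.mem_of_mem w.2 hxw⟩ w).2 hxw
    rwa [emb_nat j (n := ⟨x, M.mem_of_mem w.2 hxw⟩) hx] at this

end Emb

/-- A set, viewed as an element of the universe. -/
abbrev inV (x : ZFSet.{u}) : V.{u} := ⟨x, trivial⟩

/-! ### Transitive classes that are elementarily equivalent to the universe -/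

section Models

variable {M : TransClass.{u}} (j : Emb V M)
include j

/-- Separation in `M` for uniformly first-order properties; it holds in `V`, hence in `M` by
elementarity. -/
theorem exists_sep {α : Type*} [Finite α] {Q : ∀ N : TransClass.{u}, (α → N) → N → Prop}
    (hQ : FODef fun N (v : Option α → N) => Q N (fun a => v (some a)) (v none))
    (v : α → M) (a : M) :
    ∃ b : M, ∀ z : M, (z : ZFSet.{u}) ∈ (b : ZFSet.{u}) ↔
      (z : ZFSet.{u}) ∈ (a : ZFSet.{u}) ∧ Q M v z := by
  have fo : FODef fun N (v : Option α → N) => ∃ b : N, ∀ z : N,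
      (z : ZFSet.{u}) ∈ (b : ZFSet.{u}) ↔
        (z : ZFSet.{u}) ∈ (v none : ZFSet.{u}) ∧ Q N (fun i => v (some i)) z :=
    .ex (.all (.iff (fo_mem _ _) (.and (fo_mem _ _)
      (hQ.relabel fun o : Option α => o.elim none fun i => some (some (some i))))))
  refine fo.transfer j (fun v => ?_) (fun o : Option α => o.elim a v)
  refine ⟨inV (ZFSet.sep (fun z => Q V (fun i => v (some i)) (inV z)) (v none)), fun z => ?_⟩
  rw [ZFSet.mem_sep]

/-- A set separated from an element of `M` by a property that agrees with a uniformly first-order one,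
evaluated in `M`, belongs to `M`. -/
theorem sep_mem_class {α : Type*} [Finite α] {Q : ∀ N : TransClass.{u}, (α → N) → N → Prop}
    (hQ : FODef fun N (v : Option α → N) => Q N (fun a => v (some a)) (v none))
    (v : α → M) (a : M) {p : ZFSet.{u} → Prop}
    (hp : ∀ z : M, (z : ZFSet.{u}) ∈ (a : ZFSet.{u}) → (p z ↔ Q M v z)) :
    ZFSet.sep p a ∈ M := by
  obtain ⟨b, hb⟩ := exists_sep j hQ v a
  have : (b : ZFSet.{u}) = ZFSet.sep p a := by
    refine (M.forall_mem_iff_iff b _ ?_ fun z => ?_).1 hb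
    · intro z hz
      exact M.mem_of_mem a.2 (ZFSet.mem_sep.1 hz).1
    · rw [ZFSet.mem_sep]
      exact ⟨fun h => ⟨h.1, (hp z h.1).2 h.2⟩, fun h => ⟨h.1, (hp z h.1).1 h.2⟩⟩
  rw [← this]
  exact b.2

theorem inter_mem_class {A B : ZFSet.{u}} (hA : A ∈ M) (hB : B ∈ M) : A ∩ B ∈ M := by
  rw [← ZFSet.sep_mem]
  refine sep_mem_class j (α := Fin 1)
    (Q := fun N v z => (z : ZFSet.{u}) ∈ (v 0 : ZFSet.{u})) (fo_mem _ _) ![⟨B, hB⟩] ⟨A, hA⟩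
    fun z _ => Iff.rfl

theorem sdiff_mem_class {A B : ZFSet.{u}} (hA : A ∈ M) (hB : B ∈ M) : A \ B ∈ M := by
  rw [← ZFSet.sep_notMem]
  refine sep_mem_class j (α := Fin 1)
    (Q := fun N v z => ¬ (z : ZFSet.{u}) ∈ (v 0 : ZFSet.{u})) (.not (fo_mem _ _)) ![⟨B, hB⟩] ⟨A, hA⟩
    fun z _ => Iff.rfl

theorem pair_mem_class {a b : ZFSet.{u}} (ha : a ∈ M) (hb : b ∈ M) : ZFSet.pair a b ∈ M := by
  have fo : FODef.{u} fun N (v : Fin 2 → N) =>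
      ∃ c : N, (c : ZFSet.{u}) = ZFSet.pair (v 0 : ZFSet.{u}) (v 1) := .ex (fo_pair _ _ _)
  obtain ⟨c, hc⟩ := fo.transfer j (fun v => ⟨inV _, rfl⟩) ![⟨a, ha⟩, ⟨b, hb⟩]
  have hc' : (c : ZFSet.{u}) = ZFSet.pair a b := hc
  rw [← hc']
  exact c.2

/-- The power set of `a` in the sense of `M`. -/
theorem exists_powerset (a : M) :
    ∃ b : M, ∀ z : M, (z : ZFSet.{u}) ∈ (b : ZFSet.{u}) ↔ (z : ZFSet.{u}) ⊆ (a : ZFSet.{u}) := by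
  have fo : FODef.{u} fun N (v : Fin 1 → N) =>
      ∃ b : N, ∀ z : N, (z : ZFSet.{u}) ∈ (b : ZFSet.{u}) ↔
        (z : ZFSet.{u}) ⊆ (v 0 : ZFSet.{u}) := .ex (.all (.iff (fo_mem _ _) (fo_subset _ _)))
  exact fo.transfer j (fun v => ⟨inV (ZFSet.powerset (v 0)), fun z => ZFSet.mem_powerset⟩) ![a]

omit j in
theorem exists_transitive_superset (x : ZFSet.{u}) : ∃ t : ZFSet.{u}, x ⊆ t ∧ t.IsTransitive :=
  ⟨_, ZFSet.subset_vonNeumann_self x, ZFSet.isTransitive_vonNeumann _⟩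

theorem exists_transitive_superset_class (a : M) :
    ∃ t : M, (a : ZFSet.{u}) ⊆ t ∧ (t : ZFSet.{u}).IsTransitive := by
  have fo : FODef.{u} fun N (v : Fin 1 → N) =>
      ∃ b : N, (v 0 : ZFSet.{u}) ⊆ (b : ZFSet.{u}) ∧ (b : ZFSet.{u}).IsTransitive :=
    .ex (.and (fo_subset _ _) (fo_transitive _))
  refine fo.transfer j (fun v => ?_) ![a]
  obtain ⟨t, ht⟩ := exists_transitive_superset (v 0 : ZFSet.{u})
  exact ⟨inV t, ht⟩

theorem subset_emb_of_ordinal {α : ZFSet.{u}} (h : α.IsOrdinal) :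
    α ⊆ (j (inV α) : ZFSet.{u}) := by
  revert h
  refine ZFSet.inductionOn α fun α ih h β hβ => ?_
  have hβo := h.mem hβ
  have h1 := (emb_mem j (inV β) (inV α)).2 hβ
  have hjα := (emb_ordinal j (inV α)).2 h
  exact ZFSet.IsOrdinal.mem_of_subset_of_mem hβo hjα (ih β hβ hβo) h1

/-- Every ordinal `α` is in `M`, since it is at most the ordinal `j α` of the transitive class `M`. -/
theorem ordinal_mem_class {α : ZFSet.{u}} (h : α.IsOrdinal) : α ∈ M := by
  rcases (h.subset_iff_eq_or_mem ((emb_ordinal j (inV α)).2 h)).1 (subset_emb_of_ordinal j h)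
    with h' | h'
  · rw [h']; exact (j _).2
  · exact M.mem_of_mem (j _).2 h'

/-- Elementary embeddings of the universe are cofinal. -/
theorem exists_mem_emb (x : M) : ∃ d : V.{u}, (x : ZFSet.{u}) ∈ (j d : ZFSet.{u}) := by
  obtain ⟨x, hx⟩ := x
  change ∃ d : V.{u}, x ∈ (j d : ZFSet.{u})
  revert hx
  refine ZFSet.inductionOn x fun x ih hx => ?_
  choose d hd using fun y : {y // y ∈ x} => ih y y.2 (M.mem_of_mem hx y.2)
  -- the image of `⋃ d` covers `x`, so the image of its power set has `x` as an element
  let D : ZFSet.{u} := ZFSet.iUnion fun y => (d y : ZFSet.{u})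
  refine ⟨inV (ZFSet.powerset D), ?_⟩
  have fo : FODef.{u} fun N (v : Fin 2 → N) => ∀ z : N,
      (z : ZFSet.{u}) ⊆ (v 0 : ZFSet.{u}) → (z : ZFSet.{u}) ∈ (v 1 : ZFSet.{u}) :=
    .all (.imp (fo_subset _ _) (fo_mem _ _))
  refine (fo.elem j ![inV D, inV (ZFSet.powerset D)]).2 (fun z => ZFSet.mem_powerset.2) ⟨x, hx⟩ ?_
  intro y hy
  exact (emb_subset j (d ⟨y, hy⟩) (inV D)).2
    (ZFSet.subset_iUnion (fun y : {y // y ∈ x} => (d y : ZFSet.{u})) ⟨y, hy⟩) (hd ⟨y, hy⟩)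

end Models

/-! ### Definable hulls -/

section Hull

variable {M M' N : TransClass.{u}}

/-- An element of the hull of `X` is the unique solution of a formula with parameters in `X`. -/
theorem exists_formula_of_mem_hull {X : Set N} {y : N} (h : y ∈ hull N X) :
    ∃ φ : setLang.Formula (X ⊕ Fin 1),
      ∀ z : N, φ.Realize (Sum.elim (fun a : X => (a : N)) fun _ => z) ↔ z = y := by
  obtain ⟨φ, hφ⟩ := Set.definable_iff_exists_formula_sum.1 h
  refine ⟨φ, fun z => ?_⟩
  have := Set.ext_iff.1 hφ (fun _ => z)
  exact this.symm

theorem mem_hull_of_foDef {X : Set N} {y : N} {α : Type*}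
    {P : ∀ N : TransClass.{u}, (α → N) → N → Prop}
    (hP : FODef fun N (v : Option α → N) => P N (fun a => v (some a)) (v none))
    (v : α → N) (hv : ∀ a, v a ∈ X) (h : ∀ z, P N v z ↔ z = y) : y ∈ hull N X := by
  obtain ⟨φ, hφ⟩ := hP
  refine Set.definable_iff_exists_formula_sum.2
    ⟨φ.relabel fun o : Option α => o.elim (Sum.inr 0) fun a => Sum.inl ⟨v a, hv a⟩, ?_⟩
  ext z
  change z 0 = y ↔ Formula.Realize _ _
  rw [Formula.realize_relabel, ← h, hφ]
  rfl

theorem hull_mono {X Y : Set N} (h : X ⊆ Y) : hull N X ⊆ hull N Y :=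
  fun _ hy => Set.Definable.mono hy h

/-- If the generators of `M` are mapped by `i` into the range of `i'`, then so is all of `M`: the
formula that defines `m` from generators has a solution in `M'`, which `i'` maps to the unique
solution `i m` in `N`. -/
theorem exists_eq_of_hull_eq_univ (i : Emb M N) (i' : Emb M' N) {X : Set M}
    (hX : hull M X = Set.univ) (h : ∀ x ∈ X, ∃ x', i' x' = i x) (m : M) : ∃ m', i' m' = i m := by
  obtain ⟨φ, hφ⟩ := exists_formula_of_mem_hull (hX ▸ Set.mem_univ m : m ∈ hull M X)
  choose g hg using fun x : X => h x x.2
  have hN : ∀ z : M', φ.Realize (Sum.elim (fun a : X => i a) fun _ => i' z) ↔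
      φ.Realize (Sum.elim g fun _ => z) := fun z => by
    rw [← i'.map_formula]
    apply iff_of_eq
    congr 1
    funext a
    rcases a with a | a
    · exact (hg a).symm
    · rfl
  have hM : ∀ z : M, φ.Realize (Sum.elim (fun a : X => i a) fun _ => i z) ↔ z = m := fun z => by
    rw [← hφ, ← i.map_formula]
    apply iff_of_eq
    congr 1
    funext a
    rcases a with a | a <;> rfl
  have hmN : ∀ z : N, φ.Realize (Sum.elim (fun a : X => i a) fun _ => z) ↔ z = i m := by
    have fo : FODef fun N (v : Option X → N) => ∀ z : N,
        φ.Realize (Sum.elim (fun a : X => v (some a)) fun _ => z) ↔ (z : ZFSet.{u}) = v none := by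
      refine .all (.iff ?_ (fo_eq _ _))
      refine ⟨φ.relabel (Sum.elim (fun a => some (some a)) fun _ => none), fun N v => ?_⟩
      rw [Formula.realize_relabel]
      apply iff_of_eq
      congr 1
      funext a
      rcases a with a | a <;> rfl
    have := (fo.elem i (fun o : Option X => o.elim m (↑))).2 fun z => (hφ z).trans Subtype.ext_iff
    exact fun z => (this z).trans Subtype.ext_iff.symm
  have fo : FODef fun N (v : X → N) => ∃ z : N, φ.Realize (Sum.elim v fun _ => z) := by
    refine .ex ⟨φ.relabel (Sum.elim (fun a => some a) fun _ => none), fun N v => ?_⟩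
    rw [Formula.realize_relabel]
    apply iff_of_eq
    congr 1
    funext a
    rcases a with a | a <;> rfl
  have e : (fun a : X => i' (g a)) = fun a : X => i a := funext hg
  obtain ⟨z, hz⟩ := (fo.elem i' g).1 (by rw [e]; exact ⟨i m, (hM m).2 rfl⟩)
  exact ⟨z, (hmN _).1 ((hN z).2 hz)⟩

/-- An elementary self-embedding that fixes a set of generators is the identity. -/
theorem eq_self_of_hull_eq_univ (e : Emb M M) {X : Set M} (hX : hull M X = Set.univ)
    (h : ∀ x ∈ X, e x = x) (m : M) : e m = m := by
  obtain ⟨φ, hφ⟩ := exists_formula_of_mem_hull (hX ▸ Set.mem_univ m : m ∈ hull M X)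
  rw [← hφ]
  have := (hφ m).2 rfl
  rw [← e.map_formula] at this
  convert this using 1
  funext a
  rcases a with a | a
  · exact (h a a.2).symm
  · rfl

/-- If the range of `i` is contained in the range of `i'`, then `i` factors through `i'`. -/
theorem exists_factor (i : Emb M N) (i' : Emb M' N) (h : ∀ m, ∃ m', i' m' = i m) :
    ∃ k : Emb M M', ∀ m, i' (k m) = i m := by
  choose k hk using h
  refine ⟨⟨k, fun n φ x => ?_⟩, hk⟩
  rw [← i'.map_formula, ← i.map_formula φ x]
  apply iff_of_eq
  congr 1
  funext a
  exact hk _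

/-- If `M` is generated over the range of `j : V → M` by `x`, then every element of `M` is the value
at `x` of the image of a function. -/
theorem exists_function_rep (j : Emb V M) {x : M} (hx : hull M (Set.range j ∪ {x}) = Set.univ)
    (y : M) :
    ∃ F : V.{u}, (∀ a b c : V.{u}, ZFSet.pair (a : ZFSet.{u}) b ∈ (F : ZFSet.{u}) →
      ZFSet.pair (a : ZFSet.{u}) c ∈ (F : ZFSet.{u}) → (b : ZFSet.{u}) = c) ∧
      ZFSet.pair (x : ZFSet.{u}) y ∈ (j F : ZFSet.{u}) := by
  obtain ⟨φ, hφ⟩ := exists_formula_of_mem_hull (hx ▸ Set.mem_univ y : y ∈ hull M _)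
  have hg : ∀ a : ↥(Set.range j ∪ {x}), ∃ s : V.{u} ⊕ Unit, Sum.elim j (fun _ => x) s = a := by
    rintro ⟨a, ⟨b, rfl⟩ | rfl⟩
    exacts [⟨Sum.inl b, rfl⟩, ⟨Sum.inr (), rfl⟩]
  choose g hg using hg
  -- `R N v ξ η`: with parameters `v`, the formula defines `η` from `ξ` in `N`
  let R : ∀ N : TransClass.{u}, (V.{u} → N) → N → N → Prop := fun N v ξ η => ∀ ζ : N,
    φ.Realize (Sum.elim (fun a => Sum.elim v (fun _ => ξ) (g a)) fun _ => ζ) ↔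
      (ζ : ZFSet.{u}) = η
  have hR : FODef fun N (v : Option (Option V.{u}) → N) =>
      R N (fun a => v (some (some a))) (v (some none)) (v none) := by
    refine .all (.iff ?_ (fo_eq _ _))
    refine ⟨φ.relabel (Sum.elim
      (fun a => Sum.elim (fun b => some (some (some b))) (fun _ => some (some none)) (g a))
      fun _ => none), fun N v => ?_⟩
    rw [Formula.realize_relabel]
    apply iff_of_eq
    congr 1
    funext a
    rcases a with a | a
    · change v (Sum.elim _ _ (g a)) = Sum.elim _ _ (g a)
      rcases g a with b | b <;> rfl
    · rfl
  obtain ⟨d, hd⟩ := exists_mem_emb j x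
  let c : ZFSet.{u} → ZFSet.{u} := fun ξ => Classical.epsilon fun η => R V id (inV ξ) (inV η)
  let F : ZFSet.{u} := ZFSet.range
    fun ξ : {ξ // ξ ∈ ZFSet.sep (fun ξ => ∃ η, R V id (inV ξ) (inV η)) d} => ZFSet.pair ξ (c ξ)
  have hF : ∀ ξ η : V.{u}, (ξ : ZFSet.{u}) ∈ (d : ZFSet.{u}) → R V id ξ η →
      ZFSet.pair (ξ : ZFSet.{u}) η ∈ (inV F : ZFSet.{u}) := by
    intro ξ η hξ h
    refine ZFSet.mem_range.2 ⟨⟨ξ, ZFSet.mem_sep.2 ⟨hξ, η, h⟩⟩, ?_⟩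
    have h' : R V id ξ (inV (c ξ)) :=
      Classical.epsilon_spec (p := fun η => R V id ξ (inV η)) ⟨η, h⟩
    have : c ξ = η := (h (inV (c ξ))).1 ((h' (inV (c ξ))).2 rfl)
    rw [this]
  refine ⟨inV F, ?_, ?_⟩
  · intro a b b' h h'
    obtain ⟨ξ, hξ⟩ := ZFSet.mem_range.1 h
    obtain ⟨ξ', hξ'⟩ := ZFSet.mem_range.1 h'
    obtain ⟨h1, h2⟩ := ZFSet.pair_inj.1 hξ
    obtain ⟨h1', h2'⟩ := ZFSet.pair_inj.1 hξ'
    rw [← h2, ← h2', h1, h1']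
  · have fo : FODef fun N (v : V.{u} → N) => ∀ ξ η : N, (ξ : ZFSet.{u}) ∈ (v d : ZFSet.{u}) →
        R N v ξ η → ZFSet.pair (ξ : ZFSet.{u}) η ∈ (v (inV F) : ZFSet.{u}) :=
      .all (.all (.imp (fo_mem _ _) (.imp hR (fo_pair_mem _ _ _))))
    refine (fo.elem j id).2 hF x y hd fun ζ => ?_
    rw [← Subtype.ext_iff, ← hφ]
    apply iff_of_eq
    congr 1
    funext a
    rcases a with a | a
    · exact hg a
    · rfl

end Hull

/-! ### Internal embeddings and derived ultrafilters -/

/-- `i : M → N` is internal (amenable) to `M`: the restriction of `i` to any set of `M` is in `M`. -/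
def IsInternal {M N : TransClass.{u}} (i : Emb M N) : Prop :=
  ∀ x : M, ∃ g : M, ∀ z : ZFSet.{u}, z ∈ (g : ZFSet.{u}) ↔
    ∃ a : M, (a : ZFSet.{u}) ∈ (x : ZFSet.{u}) ∧ z = ZFSet.pair (a : ZFSet.{u}) (i a)

section Internal

variable {M N : TransClass.{u}}

/-- The restriction of an internal embedding to a set, described by the pairs that belong to it. -/
theorem IsInternal.exists_restrict {i : Emb M N} (hi : IsInternal i) (x : M) :
    ∃ g : M, ∀ a b : ZFSet.{u}, ZFSet.pair a b ∈ (g : ZFSet.{u}) ↔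
      ∃ a' : M, (a' : ZFSet.{u}) = a ∧ a ∈ (x : ZFSet.{u}) ∧ b = i a' := by
  obtain ⟨g, hg⟩ := hi x
  refine ⟨g, fun a b => ?_⟩
  rw [hg]
  constructor
  · rintro ⟨a', ha', h⟩
    obtain ⟨rfl, rfl⟩ := ZFSet.pair_inj.1 h
    exact ⟨a', rfl, ha', rfl⟩
  · rintro ⟨a', rfl, ha, rfl⟩
    exact ⟨a', ha, rfl⟩

/-- The target of an embedding internal to `M` is contained in `M`, because it is covered by the sets
`i (j d)`, which are second components of pairs in a restriction of `i`. -/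
theorem IsInternal.target_subset {i : Emb M N} (hi : IsInternal i) (j : Emb V M) {x : ZFSet.{u}}
    (hx : x ∈ N) : x ∈ M := by
  obtain ⟨d, hd⟩ := exists_mem_emb (i.comp j) ⟨x, hx⟩
  obtain ⟨s, hs⟩ : ∃ s : M, (j d : ZFSet.{u}) ∈ (s : ZFSet.{u}) :=
    ⟨j (inV {(d : ZFSet.{u})}), (emb_mem j d (inV _)).2 (by simp)⟩
  obtain ⟨g, hg⟩ := hi.exists_restrict s
  have h := (hg (j d) (i (j d))).2 ⟨j d, rfl, hs, rfl⟩
  exact M.mem_of_mem (M.pair_mem g.2 h).2 hd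

/-- If `d` is not tail uniform in `M`, then every embedding internal to `M` is continuous at `d`:
otherwise the supremum `ρ` of the image of `d` is an element of `i d`, and the sets `A` with
`ρ ∈ i A` form, in `M`, a tail uniform countably complete ultrafilter on `d`. -/
theorem mem_emb_iff_of_not_tailUniform (j : Emb V M) {i : Emb M N} (hi : IsInternal i) {d : M}
    (hd : (d : ZFSet.{u}).IsOrdinal) (h : ¬ IsTailUniformIn M d) (x : ZFSet.{u}) :
    x ∈ (i d : ZFSet.{u}) ↔
      ∃ b : M, (b : ZFSet.{u}) ∈ (d : ZFSet.{u}) ∧ x ∈ (i b : ZFSet.{u}) := by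
  have hid := (emb_ordinal i d).2 hd
  let ρ : ZFSet.{u} := ZFSet.sep
    (fun x => ∃ b : M, (b : ZFSet.{u}) ∈ (d : ZFSet.{u}) ∧ x ∈ (i b : ZFSet.{u})) (i d)
  have hρ : ∀ {x}, x ∈ ρ ↔
      ∃ b : M, (b : ZFSet.{u}) ∈ (d : ZFSet.{u}) ∧ x ∈ (i b : ZFSet.{u}) := fun {x} => by
    rw [ZFSet.mem_sep]
    refine ⟨fun h => h.2, fun h => ⟨?_, h⟩⟩
    obtain ⟨b, hb, hx⟩ := h
    exact hid.mem_trans hx ((emb_mem i b d).2 hb)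
  have hρo : ρ.IsOrdinal := by
    refine ZFSet.isOrdinal_iff_forall_mem_isOrdinal.2 ⟨fun y hy z hz => ?_, fun y hy => ?_⟩
    · obtain ⟨b, hb, hy⟩ := hρ.1 hy
      exact hρ.2 ⟨b, hb, ((emb_ordinal i b).2 (hd.mem hb)).mem_trans hz hy⟩
    · exact hid.mem (ZFSet.mem_sep.1 hy).1
  rw [← hρ]
  rcases (hρo.subset_iff_eq_or_mem hid).1 ZFSet.sep_subset with e | hmem
  · rw [e]
  exfalso
  apply h
  have hρM : ρ ∈ M := ordinal_mem_class j hρo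
  obtain ⟨p, hp⟩ := exists_powerset j d
  obtain ⟨g, hg⟩ := hi.exists_restrict p
  obtain ⟨D, hD⟩ := exists_sep j (α := Fin 2)
    (Q := fun N v z => ∃ y : N, ZFSet.pair (z : ZFSet.{u}) y ∈ (v 0 : ZFSet.{u}) ∧
      (v 1 : ZFSet.{u}) ∈ (y : ZFSet.{u}))
    (.ex (.and (fo_pair_mem _ _ _) (fo_mem _ _))) ![g, ⟨ρ, hρM⟩] p
  have hD' : ∀ A : M, (A : ZFSet.{u}) ∈ (D : ZFSet.{u}) ↔
      (A : ZFSet.{u}) ⊆ d ∧ ρ ∈ (i A : ZFSet.{u}) := by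
    intro A
    rw [hD, hp]
    refine and_congr_right fun hA => ?_
    constructor
    · rintro ⟨y, hy, hρy⟩
      obtain ⟨a', ha', -, e⟩ := (hg _ _).1 hy
      rw [← Subtype.ext ha', ← e]
      exact hρy
    · intro hρA
      have := (hg A (i A)).2 ⟨A, rfl, (hp A).2 hA, rfl⟩
      exact ⟨⟨_, (M.pair_mem g.2 this).2⟩, this, hρA⟩
  have memM : ∀ {A}, A ∈ (D : ZFSet.{u}) → A ∈ M := fun hA => M.mem_of_mem D.2 hA
  -- the image of the relative complement of `B` in `A`
  have hdiff : ∀ A B : M, (i ⟨A \ B, sdiff_mem_class j A.2 B.2⟩ : ZFSet.{u}) =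
      (i A : ZFSet.{u}) \ (i B : ZFSet.{u}) := by
    intro A B
    have fo : FODef.{u} fun N (v : Fin 3 → N) => ∀ z : N, (z : ZFSet.{u}) ∈ (v 0 : ZFSet.{u}) ↔
        (z : ZFSet.{u}) ∈ (v 1 : ZFSet.{u}) ∧ ¬ (z : ZFSet.{u}) ∈ (v 2 : ZFSet.{u}) :=
      .all (.iff (fo_mem _ _) (.and (fo_mem _ _) (.not (fo_mem _ _))))
    refine (N.forall_mem_iff_iff _ _ (fun z hz => ?_) fun z => ZFSet.mem_sdiff.symm).1
      ((fo.elem i ![⟨A \ B, sdiff_mem_class j A.2 B.2⟩, A, B]).2 fun z => ZFSet.mem_sdiff)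
    exact N.mem_of_mem (i A).2 (ZFSet.mem_sdiff.1 hz).1
  have hinter : ∀ A B : M, ρ ∈ (i A : ZFSet.{u}) → ρ ∈ (i B : ZFSet.{u}) →
      ρ ∈ (i ⟨A ∩ B, inter_mem_class j A.2 B.2⟩ : ZFSet.{u}) := by
    intro A B hA hB
    have fo : FODef.{u} fun N (v : Fin 3 → N) => ∀ z : N, (z : ZFSet.{u}) ∈ (v 1 : ZFSet.{u}) →
        (z : ZFSet.{u}) ∈ (v 2 : ZFSet.{u}) → (z : ZFSet.{u}) ∈ (v 0 : ZFSet.{u}) :=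
      .all (.imp (fo_mem _ _) (.imp (fo_mem _ _) (fo_mem _ _)))
    exact (fo.elem i ![⟨A ∩ B, inter_mem_class j A.2 B.2⟩, A, B]).2
      (fun z h1 h2 => ZFSet.mem_inter.2 ⟨h1, h2⟩) ⟨ρ, N.mem_of_mem (i A).2 hA⟩ hA hB
  refine ⟨D, D.2, fun A hA => ((hD' ⟨A, memM hA⟩).1 hA).1, fun h0 => ?_, (hD' d).2 ⟨fun _ h => h, hmem⟩,
    fun A hA B hB hAB hBd => ?_, fun A hA B hB => ?_, fun A hA hAd => ?_, fun β hβ => ?_,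
    fun f hf hfun => ?_⟩
  · have := ((hD' ⟨∅, memM h0⟩).1 h0).2
    rw [(emb_empty i _).2 rfl] at this
    exact ZFSet.notMem_empty _ this
  · exact (hD' ⟨B, hB⟩).2 ⟨hBd,
      (emb_subset i ⟨A, memM hA⟩ ⟨B, hB⟩).2 hAB ((hD' ⟨A, memM hA⟩).1 hA).2⟩
  · have h1 := (hD' ⟨A, memM hA⟩).1 hA
    have h2 := (hD' ⟨B, memM hB⟩).1 hB
    exact (hD' ⟨A ∩ B, inter_mem_class j (memM hA) (memM hB)⟩).2
      ⟨fun z hz => h1.1 (ZFSet.mem_inter.1 hz).1, hinter ⟨A, memM hA⟩ ⟨B, memM hB⟩ h1.2 h2.2⟩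
  · by_cases hρA : ρ ∈ (i ⟨A, hA⟩ : ZFSet.{u})
    · exact Or.inl ((hD' ⟨A, hA⟩).2 ⟨hAd, hρA⟩)
    · refine Or.inr ((hD' ⟨_, sdiff_mem_class j d.2 hA⟩).2 ⟨fun _ h => (ZFSet.mem_sdiff.1 h).1, ?_⟩)
      rw [hdiff d ⟨A, hA⟩]
      exact ZFSet.mem_sdiff.2 ⟨hmem, hρA⟩
  · have hβM := M.mem_of_mem d.2 hβ
    refine (hD' ⟨_, sdiff_mem_class j d.2 hβM⟩).2 ⟨fun _ h => (ZFSet.mem_sdiff.1 h).1, ?_⟩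
    rw [hdiff d ⟨β, hβM⟩]
    exact ZFSet.mem_sdiff.2 ⟨hmem, fun hc => ZFSet.mem_irrefl ρ (hρ.2 ⟨⟨β, hβM⟩, hβ, hc⟩)⟩
  · -- the sequence `i f` is indexed by `ω`, and its terms are the images of the terms of `f`
    have hsep : ZFSet.sep (fun x => ∀ n A : ZFSet.{u}, ZFSet.pair n A ∈ f → x ∈ A) d ∈ M := by
      refine sep_mem_class j (α := Fin 1) (Q := fun N v z => ∀ n A : N,
        ZFSet.pair (n : ZFSet.{u}) A ∈ (v 0 : ZFSet.{u}) → (z : ZFSet.{u}) ∈ (A : ZFSet.{u}))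
        (.all (.all (.imp (fo_pair_mem _ _ _) (fo_mem _ _)))) ![⟨f, hf⟩] d fun z _ => ?_
      exact ⟨fun H n A h => H n A h, fun H n A h =>
        H ⟨n, (M.pair_mem hf h).1⟩ ⟨A, (M.pair_mem hf h).2⟩ h⟩
    have hS : ∀ x, x ∈ ZFSet.sep (fun x => ∀ n A : ZFSet.{u}, ZFSet.pair n A ∈ f → x ∈ A) d ↔
      x ∈ (d : ZFSet.{u}) ∧ ∀ n A : ZFSet.{u}, ZFSet.pair n A ∈ f → x ∈ A :=
      fun x => ZFSet.mem_sep
    generalize ZFSet.sep _ _ = S at hsep hS ⊢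
    refine (hD' ⟨S, hsep⟩).2 ⟨fun x hx => ((hS x).1 hx).1, ?_⟩
    have fo : FODef.{u} fun N (v : Fin 3 → N) => ∀ x : N, (x : ZFSet.{u}) ∈ (v 0 : ZFSet.{u}) →
        (∀ n A : N, ZFSet.pair (n : ZFSet.{u}) A ∈ (v 1 : ZFSet.{u}) →
          (x : ZFSet.{u}) ∈ (A : ZFSet.{u})) → (x : ZFSet.{u}) ∈ (v 2 : ZFSet.{u}) :=
      .all (.imp (fo_mem _ _) (.imp (.all (.all (.imp (fo_pair_mem _ _ _) (fo_mem _ _))))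
        (fo_mem _ _)))
    refine (fo.elem i ![d, ⟨f, hf⟩, ⟨S, hsep⟩]).2 (fun x hx H => (hS x).2 ⟨hx, fun n A h =>
      H ⟨n, (M.pair_mem hf h).1⟩ ⟨A, (M.pair_mem hf h).2⟩ h⟩) ⟨ρ, N.mem_of_mem (i d).2 hmem⟩ hmem ?_
    intro n A hnA
    have hω : (j (inV ZFSet.omega) : ZFSet.{u}) = ZFSet.omega := emb_omega j rfl
    have fo2 : FODef.{u} fun N (v : Fin 2 → N) => ∀ n A : N,
        ZFSet.pair (n : ZFSet.{u}) A ∈ (v 0 : ZFSet.{u}) →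
          (n : ZFSet.{u}) ∈ (v 1 : ZFSet.{u}) :=
      .all (.all (.imp (fo_pair_mem _ _ _) (fo_mem _ _)))
    have hn : (n : ZFSet.{u}) ∈ ZFSet.omega.{u} := by
      have := (fo2.elem i ![⟨f, hf⟩, j (inV ZFSet.omega)]).2 (fun n A h => ?_) n A hnA
      · change _ ∈ (i (j (inV ZFSet.omega)) : ZFSet.{u}) at this
        rwa [emb_omega i hω] at this
      · change (n : ZFSet.{u}) ∈ (j (inV ZFSet.omega) : ZFSet.{u})
        rw [hω]
        exact (ZFSet.pair_mem_prod.1 (hfun.1 h)).1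
    obtain ⟨B, hB, huniq⟩ := hfun.2 n hn
    have hnM := (M.pair_mem hf hB).1
    have hBD := (ZFSet.pair_mem_prod.1 (hfun.1 hB)).2
    have e1 : (i ⟨n, hnM⟩ : ZFSet.{u}) = n := emb_nat i hn
    have h1 := (emb_pair_mem i ⟨n, hnM⟩ ⟨B, memM hBD⟩ ⟨f, hf⟩).2 hB
    rw [e1] at h1
    have hsv := (emb_singleValued i (f := ⟨f, hf⟩)).2 (fun a b c hab hac => by
      obtain ⟨w, -, hw⟩ := hfun.2 a (ZFSet.pair_mem_prod.1 (hfun.1 hab)).1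
      rw [hw _ hab, hw _ hac]) n A _ hnA h1
    rw [hsv]
    exact ((hD' ⟨B, memM hBD⟩).1 hBD).2

end Internal

/-! ### Factoring through an internal embedding -/

/-- A function whose restriction to `Z` is the Mostowski collapse of the membership relation on `Z`. -/
theorem exists_collapse_fun (Z : ZFSet.{u}) : ∃ C : ZFSet.{u} → ZFSet.{u}, ∀ z d : ZFSet.{u},
    d ∈ C z ↔ ∃ w ∈ Z, w ∈ z ∧ C w = d := by
  let G : ∀ z : ZFSet.{u}, (∀ w, w ∈ z → ZFSet.{u}) → ZFSet.{u} := fun z ih =>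
    ZFSet.range fun w : {w // w ∈ Z ∩ z} => ih w (ZFSet.mem_inter.1 w.2).2
  refine ⟨ZFSet.mem_wf.fix G, fun z d => ?_⟩
  rw [WellFounded.fix_eq, ZFSet.mem_range]
  constructor
  · rintro ⟨⟨w, hw⟩, h⟩
    exact ⟨w, (ZFSet.mem_inter.1 hw).1, (ZFSet.mem_inter.1 hw).2, h⟩
  · rintro ⟨w, hw, hwz, h⟩
    exact ⟨⟨w, ZFSet.mem_inter.2 ⟨hw, hwz⟩⟩, h⟩

section

variable {M M' N : TransClass.{u}}

/-- The Mostowski collapse of a set of `M` is in `M`. The two clauses say that the set of pairs `π` is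
defined on all of `Z` and satisfies the recursion equation of the collapse. -/
theorem exists_collapse (j : Emb V M) (Z : M) : ∃ π : M,
    (∀ z : M, (z : ZFSet.{u}) ∈ (Z : ZFSet.{u}) →
      ∃ c : M, ZFSet.pair (z : ZFSet.{u}) c ∈ (π : ZFSet.{u})) ∧
    ∀ z c : M, ZFSet.pair (z : ZFSet.{u}) c ∈ (π : ZFSet.{u}) → ∀ d : M,
      (d : ZFSet.{u}) ∈ (c : ZFSet.{u}) ↔ ∃ w : M, (w : ZFSet.{u}) ∈ (Z : ZFSet.{u}) ∧
        (w : ZFSet.{u}) ∈ (z : ZFSet.{u}) ∧ ZFSet.pair (w : ZFSet.{u}) d ∈ (π : ZFSet.{u}) := by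
  have fo : FODef.{u} fun N (v : Fin 1 → N) => ∃ π : N,
      (∀ z : N, (z : ZFSet.{u}) ∈ (v 0 : ZFSet.{u}) →
        ∃ c : N, ZFSet.pair (z : ZFSet.{u}) c ∈ (π : ZFSet.{u})) ∧
      ∀ z c : N, ZFSet.pair (z : ZFSet.{u}) c ∈ (π : ZFSet.{u}) → ∀ d : N,
        (d : ZFSet.{u}) ∈ (c : ZFSet.{u}) ↔ ∃ w : N, (w : ZFSet.{u}) ∈ (v 0 : ZFSet.{u}) ∧
          (w : ZFSet.{u}) ∈ (z : ZFSet.{u}) ∧ ZFSet.pair (w : ZFSet.{u}) d ∈ (π : ZFSet.{u}) :=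
    .ex (.and (.all (.imp (fo_mem _ _) (.ex (fo_pair_mem _ _ _))))
      (.all (.all (.imp (fo_pair_mem _ _ _) (.all (.iff (fo_mem _ _)
        (.ex (.and (fo_mem _ _) (.and (fo_mem _ _) (fo_pair_mem _ _ _))))))))))
  refine fo.transfer j (fun v => ?_) ![Z]
  obtain ⟨C, hC⟩ := exists_collapse_fun (v 0 : ZFSet.{u})
  have hπ : ∀ a b : ZFSet.{u}, ZFSet.pair a b ∈
      ZFSet.range (fun z : {z // z ∈ (v 0 : ZFSet.{u})} => ZFSet.pair z (C z)) ↔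
        a ∈ (v 0 : ZFSet.{u}) ∧ C a = b := by
    intro a b
    rw [ZFSet.mem_range]
    constructor
    · rintro ⟨⟨z, hz⟩, h⟩
      obtain ⟨rfl, rfl⟩ := ZFSet.pair_inj.1 h
      exact ⟨hz, rfl⟩
    · rintro ⟨h, rfl⟩
      exact ⟨⟨a, h⟩, rfl⟩
  refine ⟨inV (ZFSet.range fun z : {z // z ∈ (v 0 : ZFSet.{u})} => ZFSet.pair z (C z)),
    fun z hz => ⟨inV (C z), (hπ _ _).2 ⟨hz, rfl⟩⟩, fun z c hzc d => ?_⟩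
  rw [← ((hπ _ _).1 hzc).2, hC]
  constructor
  · rintro ⟨w, hw, hwz, h⟩
    exact ⟨inV w, hw, hwz, (hπ _ _).2 ⟨hw, h⟩⟩
  · rintro ⟨w, hw, hwz, h⟩
    exact ⟨w, hw, hwz, ((hπ _ _).1 h).2⟩

/-- The composition of the relations `f` and `g`, restricted to `x`. -/
theorem exists_comp (j : Emb V M) (x f g : M) : ∃ h : M, ∀ q : M, (q : ZFSet.{u}) ∈ (h : ZFSet.{u}) ↔
    ∃ a b c : M, (q : ZFSet.{u}) = ZFSet.pair (a : ZFSet.{u}) c ∧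
      (a : ZFSet.{u}) ∈ (x : ZFSet.{u}) ∧ ZFSet.pair (a : ZFSet.{u}) b ∈ (f : ZFSet.{u}) ∧
      ZFSet.pair (b : ZFSet.{u}) c ∈ (g : ZFSet.{u}) := by
  have fo : FODef.{u} fun N (v : Fin 3 → N) => ∃ h : N, ∀ q : N,
      (q : ZFSet.{u}) ∈ (h : ZFSet.{u}) ↔
      ∃ a b c : N, (q : ZFSet.{u}) = ZFSet.pair (a : ZFSet.{u}) c ∧
      (a : ZFSet.{u}) ∈ (v 0 : ZFSet.{u}) ∧ ZFSet.pair (a : ZFSet.{u}) b ∈ (v 1 : ZFSet.{u}) ∧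
      ZFSet.pair (b : ZFSet.{u}) c ∈ (v 2 : ZFSet.{u}) :=
    .ex (.all (.iff (fo_mem _ _) (.ex (.ex (.ex (.and (fo_pair _ _ _) (.and (fo_mem _ _)
      (.and (fo_pair_mem _ _ _) (fo_pair_mem _ _ _)))))))))
  refine fo.transfer j (fun v => ?_) ![x, f, g]
  refine ⟨inV (ZFSet.sep (fun q => ∃ a b c : V.{u}, q = ZFSet.pair (a : ZFSet.{u}) c ∧
      (a : ZFSet.{u}) ∈ (v 0 : ZFSet.{u}) ∧ ZFSet.pair (a : ZFSet.{u}) b ∈ (v 1 : ZFSet.{u}) ∧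
      ZFSet.pair (b : ZFSet.{u}) c ∈ (v 2 : ZFSet.{u}))
    (ZFSet.prod (v 0) (ZFSet.sUnion (ZFSet.sUnion (v 2))))), fun q => ?_⟩
  rw [ZFSet.mem_sep]
  refine ⟨fun h => h.2, fun h => ⟨?_, h⟩⟩
  obtain ⟨a, b, c, hq, ha, -, hbc⟩ := h
  rw [hq, ZFSet.pair_mem_prod]
  refine ⟨ha, ZFSet.mem_sUnion.2 ⟨{(b : ZFSet.{u}), (c : ZFSet.{u})},
    ZFSet.mem_sUnion.2 ⟨_, hbc, by simp [ZFSet.pair]⟩, by simp⟩⟩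

/-- Suppose `i = i' ∘ k`, where `i : M → N` is internal to `M`, and the target `M'` of `k` is
generated by one element `x₀` over `k ∘ j : V → M'`. Then `k` is internal to `M`.

For transitive `t ∈ M`, the set `Z = i'[k t]` is in `M`, because its elements are the values at
`i' x₀` of images under `i` of functions from one set. The map `i'` on `k t` is the inverse of the
Mostowski collapse of `Z`, so that `k` on `t` is the composition of `i` with this collapse. -/
theorem isInternal_of_comp (j : Emb V M) (k : Emb M M') (i : Emb M N) (i' : Emb M' N)
    (hi : IsInternal i) (hk : ∀ m, i' (k m) = i m) {x₀ : M'}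
    (hx₀ : hull M' (Set.range (k.comp j) ∪ {x₀}) = Set.univ) : IsInternal k := by
  intro x
  obtain ⟨t, hxt, ht⟩ := exists_transitive_superset_class j x
  have hkt : (k t : ZFSet.{u}).IsTransitive := (emb_transitive k t).2 ht
  -- a set `S` of functions whose images represent all elements of `k t`
  choose F hF1 hF2 using fun y : {y // y ∈ (k t : ZFSet.{u})} =>
    exists_function_rep (k.comp j) hx₀ ⟨y, M'.mem_of_mem (k t).2 y.2⟩
  let S : V.{u} := inV (ZFSet.range fun y : {y // y ∈ (k t : ZFSet.{u})} => (F y : ZFSet.{u}))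
  have hS : ∀ f : M, (f : ZFSet.{u}) ∈ (j S : ZFSet.{u}) →
      ∀ a b c : M, ZFSet.pair (a : ZFSet.{u}) b ∈ (f : ZFSet.{u}) →
        ZFSet.pair (a : ZFSet.{u}) c ∈ (f : ZFSet.{u}) → (b : ZFSet.{u}) = c := by
    have fo : FODef.{u} fun N (v : Fin 1 → N) =>
        ∀ f : N, (f : ZFSet.{u}) ∈ (v 0 : ZFSet.{u}) →
          ∀ a b c : N, ZFSet.pair (a : ZFSet.{u}) b ∈ (f : ZFSet.{u}) →
          ZFSet.pair (a : ZFSet.{u}) c ∈ (f : ZFSet.{u}) → (b : ZFSet.{u}) = c :=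
      .all (.imp (fo_mem _ _) (fo_singleValued _))
    refine (fo.elem j ![S]).2 fun f hf => ?_
    obtain ⟨y, hy⟩ := ZFSet.mem_range.1 hf
    have := hF1 y
    rwa [show F y = f from Subtype.ext hy] at this
  obtain ⟨g, hg⟩ := hi.exists_restrict (j S)
  have hN : ∀ {z}, z ∈ N → z ∈ M := fun hz => hi.target_subset j hz
  obtain ⟨Z, hZ⟩ := exists_sep j (α := Fin 2)
    (Q := fun N v z => ∃ f b : N, ZFSet.pair (f : ZFSet.{u}) b ∈ (v 0 : ZFSet.{u}) ∧
      ZFSet.pair (v 1 : ZFSet.{u}) z ∈ (b : ZFSet.{u}))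
    (.ex (.ex (.and (fo_pair_mem _ _ _) (fo_pair_mem _ _ _))))
    ![g, ⟨i' x₀, hN (i' x₀).2⟩] ⟨i t, hN (i t).2⟩
  have hZ' : ∀ z : ZFSet.{u}, z ∈ (Z : ZFSet.{u}) ↔
      ∃ y : M', (y : ZFSet.{u}) ∈ (k t : ZFSet.{u}) ∧ (i' y : ZFSet.{u}) = z := by
    intro z
    constructor
    · intro hz
      obtain ⟨hzt, f, b, hfb, hzb⟩ := (hZ ⟨z, M.mem_of_mem Z.2 hz⟩).1 hz
      change z ∈ (i t : ZFSet.{u}) at hzt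
      change ZFSet.pair (i' x₀ : ZFSet.{u}) z ∈ (b : ZFSet.{u}) at hzb
      obtain ⟨f', hf', hfS, hb⟩ := (hg _ _).1 hfb
      obtain rfl : f' = f := Subtype.ext hf'
      rw [hb] at hzb
      have hsv := (emb_singleValued i).2 (hS f' hfS)
      rw [← hk] at hzt hzb hsv
      have fo : FODef.{u} fun N (v : Fin 3 → N) => ∃ z : N, (z : ZFSet.{u}) ∈ (v 0 : ZFSet.{u}) ∧
          ZFSet.pair (v 1 : ZFSet.{u}) z ∈ (v 2 : ZFSet.{u}) :=
        .ex (.and (fo_mem _ _) (fo_pair_mem _ _ _))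
      obtain ⟨y, hy, hyf⟩ := (fo.elem i' ![k t, x₀, k f']).1
        ⟨⟨z, N.mem_of_mem (i' (k t)).2 hzt⟩, hzt, hzb⟩
      exact ⟨y, hy, hsv _ _ ⟨z, N.mem_of_mem (i' (k t)).2 hzt⟩ ((emb_pair_mem i' _ _ _).2 hyf) hzb⟩
    · rintro ⟨y, hy, rfl⟩
      refine (hZ ⟨i' y, hN (i' y).2⟩).2 ⟨?_, j (F ⟨y, hy⟩),
        ⟨i (j (F ⟨y, hy⟩)), hN (i (j (F ⟨y, hy⟩))).2⟩, (hg _ _).2 ⟨_, rfl, ?_, rfl⟩, ?_⟩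
      · change (i' y : ZFSet.{u}) ∈ (i t : ZFSet.{u})
        rw [← hk, emb_mem]
        exact hy
      · exact (emb_mem j _ S).2 (ZFSet.mem_range.2 ⟨_, rfl⟩)
      · change ZFSet.pair (i' x₀ : ZFSet.{u}) (i' y) ∈ (i (j (F ⟨y, hy⟩)) : ZFSet.{u})
        rw [← hk, emb_pair_mem]
        exact hF2 ⟨y, hy⟩
  obtain ⟨π, hπ1, hπ2⟩ := exists_collapse j Z
  have collapse_eq : ∀ y : ZFSet.{u}, ∀ hy : y ∈ M', y ∈ (k t : ZFSet.{u}) → ∀ c : M,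
      ZFSet.pair (i' ⟨y, hy⟩ : ZFSet.{u}) c ∈ (π : ZFSet.{u}) → (c : ZFSet.{u}) = y := by
    intro y
    refine ZFSet.inductionOn y fun y ih hy hyt c hc => ?_
    refine (M.forall_mem_iff_iff c y (fun d hd => ?_) fun d => ?_).1
      (hπ2 ⟨i' ⟨y, hy⟩, hN (i' _).2⟩ c hc)
    · have hdM := M'.mem_of_mem hy hd
      have hdt := hkt.mem_trans hd hyt
      obtain ⟨c', hc'⟩ := hπ1 ⟨i' ⟨d, hdM⟩, hN (i' _).2⟩ ((hZ' _).2 ⟨⟨d, hdM⟩, hdt, rfl⟩)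
      rw [← ih d hd hdM hdt c' hc']
      exact c'.2
    · constructor
      · rintro ⟨w, hw, hwy, hwd⟩
        obtain ⟨y', hy', e⟩ := (hZ' _).1 hw
        change (w : ZFSet.{u}) ∈ (i' ⟨y, hy⟩ : ZFSet.{u}) at hwy
        rw [← e] at hwy hwd
        have hy'y : (y' : ZFSet.{u}) ∈ y := (emb_mem i' _ _).1 hwy
        rw [ih y' hy'y y'.2 hy' d hwd]
        exact hy'y
      · intro hd
        have hdM := M'.mem_of_mem hy hd
        have hdt := hkt.mem_trans hd hyt
        have hdZ : (i' ⟨d, hdM⟩ : ZFSet.{u}) ∈ (Z : ZFSet.{u}) := (hZ' _).2 ⟨⟨d, hdM⟩, hdt, rfl⟩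
        obtain ⟨c', hc'⟩ := hπ1 ⟨i' ⟨d, hdM⟩, hN (i' _).2⟩ hdZ
        have e := ih d hd hdM hdt c' hc'
        refine ⟨⟨i' ⟨d, hdM⟩, hN (i' _).2⟩, hdZ, (emb_mem i' _ _).2 hd, ?_⟩
        obtain rfl : c' = d := Subtype.ext e
        exact hc'
  obtain ⟨f, hf⟩ := hi.exists_restrict x
  obtain ⟨h, hh⟩ := exists_comp j x f π
  refine ⟨h, fun z => ⟨fun hz => ?_, ?_⟩⟩
  · obtain ⟨a, b, c, hzac, ha, hab, hbc⟩ := (hh ⟨z, M.mem_of_mem h.2 hz⟩).1 hz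
    refine ⟨a, ha, hzac.trans ?_⟩
    obtain ⟨a', ha', -, e⟩ := (hf _ _).1 hab
    obtain rfl : a' = a := Subtype.ext ha'
    rw [e, ← hk] at hbc
    rw [collapse_eq (k a') (k a').2 ((emb_mem k a' t).2 (hxt ha)) c hbc]
  · rintro ⟨a, ha, rfl⟩
    have hat := (emb_mem k a t).2 (hxt ha)
    obtain ⟨c, hc⟩ := hπ1 ⟨i' (k a), hN (i' _).2⟩ ((hZ' _).2 ⟨k a, hat, rfl⟩)
    have e := collapse_eq (k a) (k a).2 hat c hc
    have hkM : (k a : ZFSet.{u}) ∈ M := e ▸ c.2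
    refine (hh ⟨_, pair_mem_class j a.2 hkM⟩).2 ⟨a, ⟨i a, hN (i a).2⟩, ⟨k a, hkM⟩, rfl, ha,
      (hf _ _).2 ⟨a, rfl, ha, rfl⟩, ?_⟩
    have hc' : ZFSet.pair (i' (k a) : ZFSet.{u}) c ∈ (π : ZFSet.{u}) := hc
    rw [e, hk] at hc'
    exact hc'

end

/-! ### Suprema of images and the universal property of Ketonen embeddings -/

section

variable {M M' N : TransClass.{u}} {δ : Cardinal.{u}}

theorem mem_supImage {j : Emb V M} {x : ZFSet.{u}} :
    x ∈ supImage j δ ↔ ∃ a < δ.ord, x ∈ (j (inV a.toZFSet) : ZFSet.{u}) := by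
  rw [supImage, ZFSet.mem_iUnion]
  exact ⟨fun ⟨a, ha⟩ => ⟨a, a.2, ha⟩, fun ⟨a, h, ha⟩ => ⟨⟨a, h⟩, ha⟩⟩

theorem isOrdinal_supImage (j : Emb V M) (δ : Cardinal.{u}) : (supImage j δ).IsOrdinal := by
  have ho : ∀ a : Ordinal.{u}, (j (inV a.toZFSet) : ZFSet.{u}).IsOrdinal := fun a =>
    (emb_ordinal j _).2 (ZFSet.isOrdinal_toZFSet a)
  refine ZFSet.isOrdinal_iff_forall_mem_isOrdinal.2 ⟨fun y hy z hz => ?_, fun y hy => ?_⟩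
  · obtain ⟨a, ha, hy⟩ := mem_supImage.1 hy
    exact mem_supImage.2 ⟨a, ha, (ho a).mem_trans hz hy⟩
  · obtain ⟨a, ha, hy⟩ := mem_supImage.1 hy
    exact (ho a).mem hy

theorem supImage_mem (j : Emb V M) (δ : Cardinal.{u}) : supImage j δ ∈ M :=
  ordinal_mem_class j (isOrdinal_supImage j δ)

/-- `sup j[δ]` as an element of the target of `j`. -/
noncomputable def supImageIn (j : Emb V M) (δ : Cardinal.{u}) : M := ⟨supImage j δ, supImage_mem j δ⟩

/-- Since `δ` is a limit ordinal, its elements are mapped to elements of the supremum. -/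
theorem emb_mem_supImage (hδ : δ.IsRegular) (j : Emb V M) {a : Ordinal.{u}} (ha : a < δ.ord) :
    (j (inV a.toZFSet) : ZFSet.{u}) ∈ supImage j δ := by
  refine mem_supImage.2 ⟨a + 1, (Cardinal.isSuccLimit_ord hδ.aleph0_le).succ_lt ha, ?_⟩
  exact (emb_mem j _ _).2 (Ordinal.toZFSet_mem_toZFSet_iff.2 (Order.lt_succ a))

/-- If `sup j[δ]` is not tail uniform in `M`, then an embedding `i` internal to `M` is continuous at it,
so that it is mapped to the supremum for `i ∘ j`. -/
theorem emb_supImage (hδ : δ.IsRegular) (j : Emb V M) {i : Emb M N} (hi : IsInternal i)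
    (h : ¬ IsTailUniformIn M (supImage j δ)) :
    (i (supImageIn j δ) : ZFSet.{u}) = supImage (i.comp j) δ := by
  ext x
  rw [mem_emb_iff_of_not_tailUniform (d := supImageIn j δ) j hi (isOrdinal_supImage j δ) h,
    mem_supImage]
  constructor
  · rintro ⟨b, hb, hx⟩
    obtain ⟨a, ha, hba⟩ := mem_supImage.1 hb
    have := (emb_ordinal (i.comp j) (inV a.toZFSet)).2 (ZFSet.isOrdinal_toZFSet a)
    exact ⟨a, ha, this.mem_trans hx ((emb_mem i _ _).2 hba)⟩
  · rintro ⟨a, ha, hx⟩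
    exact ⟨j (inV a.toZFSet), emb_mem_supImage hδ j ha, hx⟩

theorem setOf_eq_supImage (j : Emb V M) (δ : Cardinal.{u}) :
    {y : M | (y : ZFSet.{u}) = supImage j δ} = {supImageIn j δ} := by
  ext y
  change (y : ZFSet.{u}) = supImageIn j δ ↔ y = supImageIn j δ
  exact Subtype.ext_iff.symm

theorem IsKetonen.hull_eq {j : Emb V M} (hj : IsKetonen j δ) :
    hull M (Set.range j ∪ {supImageIn j δ}) = Set.univ := by
  rw [← setOf_eq_supImage]
  exact hj.1

theorem IsKetonen.isZeroOrder {j : Emb V M} (hj : IsKetonen j δ) : IsZeroOrder j δ :=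
  ⟨⟨_, hj.hull_eq⟩, hj.2⟩

/-- A Ketonen embedding factors into every zero order ultrapower embedding, by an internal
ultrapower embedding that maps the supremum of the image of `δ` to the corresponding supremum. -/
theorem IsKetonen.exists_factor (UA : UltrapowerAxiom.{u}) (hδ : δ.IsRegular) {j : Emb V M}
    {j' : Emb V M'} (hj : IsKetonen j δ) (hj' : IsZeroOrder j' δ) :
    ∃ k : Emb M M', IsInternalUltrapower k ∧ j' = k.comp j ∧
      k (supImageIn j δ) = supImageIn j' δ := by
  obtain ⟨N, i, i', hi, hi', hc⟩ := UA M M' j j' hj.isZeroOrder.1 hj'.1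
  have hc' : ∀ x, i (j x) = i' (j' x) := fun x => congrArg (fun e : Emb V N => e x) hc
  have hs : i (supImageIn j δ) = i' (supImageIn j' δ) := by
    apply Subtype.ext
    rw [emb_supImage hδ j hi.2 hj.2, emb_supImage hδ j' hi'.2 hj'.2, hc]
  obtain ⟨k, hk⟩ := UltraAx.exists_factor i i' (exists_eq_of_hull_eq_univ i i' hj.hull_eq (by
    rintro _ (⟨x, rfl⟩ | rfl)
    exacts [⟨j' x, (hc' x).symm⟩, ⟨_, hs.symm⟩]))
  have hkj : j' = k.comp j := by
    ext x : 1
    apply i'.injective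
    rw [← hc']
    exact (hk (j x)).symm
  obtain ⟨x₀, hx₀⟩ := hj'.1
  rw [hkj] at hx₀
  refine ⟨k, ⟨⟨x₀, ?_⟩, isInternal_of_comp j k i i' hi.2 hk hx₀⟩, hkj, i'.injective ?_⟩
  · refine Set.eq_univ_of_univ_subset (hx₀.symm.subset.trans (hull_mono ?_))
    refine Set.union_subset_union_left _ ?_
    rintro _ ⟨x, rfl⟩
    exact ⟨j x, rfl⟩
  · rw [hk, hs]

/-- An isomorphism of transitive classes is the identity. -/
theorem eq_of_surjective_emb (k : Emb M N) (hk : Function.Surjective k) :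
    M = N ∧ ∀ x, (k x : ZFSet.{u}) = x := by
  have key : ∀ x : ZFSet.{u}, ∀ hx : x ∈ M, (k ⟨x, hx⟩ : ZFSet.{u}) = x := by
    intro x
    refine ZFSet.inductionOn x fun x ih hx => ?_
    ext y
    constructor
    · intro hy
      obtain ⟨z, hz⟩ := hk ⟨y, N.mem_of_mem (k ⟨x, hx⟩).2 hy⟩
      have hzx : (z : ZFSet.{u}) ∈ x := (emb_mem k z ⟨x, hx⟩).1 (by rw [hz]; exact hy)
      have := ih z hzx z.2
      rw [show y = (k z : ZFSet.{u}) by rw [hz], this]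
      exact hzx
    · intro hy
      have := (emb_mem k ⟨y, M.mem_of_mem hx hy⟩ ⟨x, hx⟩).2 hy
      rwa [ih y hy] at this
  refine ⟨SetLike.ext fun x => ⟨fun hx => ?_, fun hx => ?_⟩, fun x => key x x.2⟩
  · rw [← key x hx]; exact (k _).2
  · obtain ⟨z, hz⟩ := hk ⟨x, hx⟩
    rw [show x = (k z : ZFSet.{u}) by rw [hz], key z z.2]
    exact z.2

/-- The factors of two Ketonen embeddings through each other fix the generators, so that they are
mutually inverse isomorphisms of transitive classes. -/
theorem IsKetonen.unique (UA : UltrapowerAxiom.{u}) (hδ : δ.IsRegular)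
    {p q : (M : TransClass.{u}) × Emb V M} (hp : IsKetonen p.2 δ) (hq : IsKetonen q.2 δ) :
    p = q := by
  obtain ⟨M, j⟩ := p
  obtain ⟨M', j'⟩ := q
  obtain ⟨k, -, hk, hks⟩ := hp.exists_factor UA hδ hq.isZeroOrder
  obtain ⟨l, -, hl, hls⟩ := hq.exists_factor UA hδ hp.isZeroOrder
  dsimp only at *
  have hkj : ∀ x, k (j x) = j' x := fun x => by rw [hk]; rfl
  have hlj : ∀ x, l (j' x) = j x := fun x => congrArg (fun e : Emb V M => e x) hl.symm
  have hkl : ∀ m, k (l m) = m := eq_self_of_hull_eq_univ (k.comp l) hq.hull_eq (by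
    rintro _ (⟨x, rfl⟩ | rfl)
    · exact (congrArg k (hlj x)).trans (hkj x)
    · exact (congrArg k hls).trans hks)
  obtain ⟨rfl, hid⟩ := eq_of_surjective_emb k fun m => ⟨l m, hkl m⟩
  congr
  ext x : 1
  rw [← hkj x]
  exact (Subtype.ext (hid _)).symm

end

/-! ### Ultrapowers of the universe -/

section Ultrapower

variable (U : Ultrafilter ZFSet.{u})

/-- The ultrapower of the universe by an ultrafilter on the class of all sets. -/
abbrev Ult : Type (u + 1) := (U : Filter ZFSet.{u}).Product fun _ => V.{u}

instance : Nonempty V.{u} := ⟨inV ∅⟩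

/-- The class of a function in the ultrapower. -/
def Ult.mk (f : ZFSet.{u} → V.{u}) : Ult U := (f : (U : Filter ZFSet.{u}).Product fun _ => V.{u})

/-- The membership relation of the ultrapower. -/
def Ult.Mem (p q : Ult U) : Prop :=
  Structure.RelMap (L := setLang) (n := 2) SetRel.mem ![p, q]

variable {U}

/-- Łoś's theorem. -/
theorem Ult.realize_mk {α : Type*} (φ : setLang.Formula α) (f : α → ZFSet.{u} → V.{u}) :
    (φ.Realize fun i => Ult.mk U (f i)) ↔ ∀ᶠ x in U, φ.Realize fun i => f i x :=
  Ultraproduct.realize_formula_cast φ f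

theorem Ult.mk_surjective : Function.Surjective (Ult.mk U) := Quotient.mk_surjective

theorem Ult.mk_eq_mk {f g : ZFSet.{u} → V.{u}} :
    Ult.mk U f = Ult.mk U g ↔ ∀ᶠ x in U, f x = g x := by
  have := Ult.realize_mk (U := U) (Term.equal (.var 0) (.var 1) : setLang.Formula (Fin 2)) ![f, g]
  simpa [Formula.realize_equal] using this

theorem Ult.mem_mk {f g : ZFSet.{u} → V.{u}} :
    Ult.Mem U (Ult.mk U f) (Ult.mk U g) ↔
      ∀ᶠ x in U, (f x : ZFSet.{u}) ∈ (g x : ZFSet.{u}) := by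
  have := Ult.realize_mk (U := U)
    (Relations.formula (L := setLang) (n := 2) SetRel.mem ![Term.var 0, Term.var 1] :
      setLang.Formula (Fin 2)) ![f, g]
  refine Iff.trans ?_ (this.trans (eventually_congr (.of_forall fun x => Formula.realize_rel)))
  refine Iff.trans ?_ Formula.realize_rel.symm
  apply iff_of_eq
  change Structure.RelMap _ _ = Structure.RelMap _ _
  congr 1
  funext a
  fin_cases a <;> rfl

theorem Ult.ext {p q : Ult U} (h : ∀ r, Ult.Mem U r p ↔ Ult.Mem U r q) : p = q := by
  obtain ⟨f, rfl⟩ := Ult.mk_surjective p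
  obtain ⟨g, rfl⟩ := Ult.mk_surjective q
  rw [Ult.mk_eq_mk]
  by_contra hne
  rw [← Ultrafilter.eventually_not] at hne
  -- choose elements of the symmetric differences
  have hx : ∀ x, ∃ z : V.{u}, f x ≠ g x →
      ¬ ((z : ZFSet.{u}) ∈ (f x : ZFSet.{u}) ↔ (z : ZFSet.{u}) ∈ (g x : ZFSet.{u})) := by
    intro x
    by_cases hfg : f x = g x
    · exact ⟨inV ∅, fun h => (h hfg).elim⟩
    · by_contra! hc
      exact hfg (Subtype.ext (ZFSet.ext fun z => (hc (inV z)).2))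
  choose z hz using hx
  have := h (Ult.mk U z)
  rw [Ult.mem_mk, Ult.mem_mk] at this
  rcases Ultrafilter.em U fun x => (z x : ZFSet.{u}) ∈ (f x : ZFSet.{u}) with h1 | h1
  · obtain ⟨x, a, b, c⟩ := (h1.and ((this.1 h1).and hne)).exists
    exact hz x c ⟨fun _ => b, fun _ => a⟩
  · have h2 := Ultrafilter.eventually_not.2 fun h => Ultrafilter.eventually_not.1 h1 (this.2 h)
    obtain ⟨x, a, b, c⟩ := (h1.and (h2.and hne)).exists
    exact hz x c ⟨fun h => (a h).elim, fun h => (b h).elim⟩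

/-- Representatives of a descending sequence in the ultrapower would, by countable completeness, take
values that form a descending sequence of sets at some point. -/
theorem Ult.wf [CountableInterFilter (U : Filter ZFSet.{u})] : WellFounded (Ult.Mem U) := by
  rw [wellFounded_iff_isEmpty_descending_chain]
  refine ⟨fun ⟨s, hs⟩ => ?_⟩
  choose f hf using fun n => Ult.mk_surjective (U := U) (s n)
  have : ∀ n, ∀ᶠ x in U, (f (n + 1) x : ZFSet.{u}) ∈ (f n x : ZFSet.{u}) := fun n => by
    rw [← Ult.mem_mk, hf, hf]
    exact hs n
  obtain ⟨x, hx⟩ := (eventually_countable_forall.2 this).exists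
  exact (wellFounded_iff_isEmpty_descending_chain.1 ZFSet.mem_wf).false
    ⟨fun n => (f n x : ZFSet.{u}), hx⟩

/-- Since `U` concentrates on a set, the membership relation of the ultrapower is set-like. -/
theorem Ult.small {d : ZFSet.{u}} (hd : ∀ᶠ x in U, x ∈ d) (q : Ult U) :
    Small.{u} {p // Ult.Mem U p q} := by
  obtain ⟨g, rfl⟩ := Ult.mk_surjective q
  let app : ZFSet.{u} → ZFSet.{u} → V.{u} := fun h x =>
    inV (Classical.epsilon fun w => ZFSet.pair x w ∈ h)
  let B : ZFSet.{u} := ZFSet.powerset (ZFSet.prod d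
    (ZFSet.iUnion fun x : {x // x ∈ d} => (g x : ZFSet.{u})))
  have hsub : {p | Ult.Mem U p (Ult.mk U g)} ⊆
      Set.range fun h : {h // h ∈ B} => Ult.mk U (app h) := by
    intro p hp
    obtain ⟨f, rfl⟩ := Ult.mk_surjective p
    let h : ZFSet.{u} := ZFSet.sep (fun z => ∃ x, z = ZFSet.pair x (f x)) (ZFSet.prod d
      (ZFSet.iUnion fun x : {x // x ∈ d} => (g x : ZFSet.{u})))
    refine ⟨⟨h, ZFSet.mem_powerset.2 ZFSet.sep_subset⟩, Ult.mk_eq_mk.2 ?_⟩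
    filter_upwards [hd, Ult.mem_mk.1 hp] with x hx hfg
    have h1 : ∃ w, ZFSet.pair x w ∈ h := ⟨f x, ZFSet.mem_sep.2 ⟨ZFSet.pair_mem_prod.2
      ⟨hx, ZFSet.mem_iUnion.2 ⟨⟨x, hx⟩, hfg⟩⟩, x, rfl⟩⟩
    obtain ⟨x', e⟩ := (ZFSet.mem_sep.1 (Classical.epsilon_spec h1)).2
    obtain ⟨e1, e2⟩ := ZFSet.pair_inj.1 e
    rw [← e1] at e2
    exact Subtype.ext e2
  exact small_subset hsub

/-- The ultrapower of the universe by a countably complete ultrafilter that concentrates on a set is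
isomorphic to a transitive class `M`. The map `c` sends a function to the element it represents, and
Łoś's theorem is stated for `M` and `c`. -/
theorem exists_ultrapower [CountableInterFilter (U : Filter ZFSet.{u})] {d : ZFSet.{u}}
    (hd : ∀ᶠ x in U, x ∈ d) :
    ∃ (M : TransClass.{u}) (c : (ZFSet.{u} → V.{u}) → M), Function.Surjective c ∧
      ∀ (n : ℕ) (φ : setLang.Formula (Fin n)) (f : Fin n → ZFSet.{u} → V.{u}),
        (φ.Realize fun i => c (f i)) ↔ ∀ᶠ x in U, φ.Realize fun i => f i x := by
  have hsmall := Ult.small hd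
  -- the Mostowski collapse of the ultrapower
  let π : Ult U → ZFSet.{u} := (Ult.wf (U := U)).fix (C := fun _ => ZFSet.{u}) fun q ih =>
    ZFSet.range fun p : {p // Ult.Mem U p q} => ih p p.2
  have hπ : ∀ q y, y ∈ π q ↔ ∃ p, Ult.Mem U p q ∧ π p = y := by
    intro q y
    change y ∈ (Ult.wf (U := U)).fix (C := fun _ => ZFSet.{u}) _ q ↔ _
    rw [WellFounded.fix_eq, ZFSet.mem_range]
    exact ⟨fun ⟨p, h⟩ => ⟨p, p.2, h⟩, fun ⟨p, hp, h⟩ => ⟨⟨p, hp⟩, h⟩⟩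
  have hinj : Function.Injective π := by
    intro p
    induction p using (Ult.wf (U := U)).induction with | _ p ih
    intro q hpq
    refine Ult.ext fun r => ⟨fun h => ?_, fun h => ?_⟩
    · obtain ⟨r', hr', e⟩ := (hπ q _).1 (hpq ▸ (hπ p _).2 ⟨r, h, rfl⟩)
      rwa [ih r h e.symm]
    · obtain ⟨r', hr', e⟩ := (hπ p _).1 (hpq ▸ (hπ q _).2 ⟨r, h, rfl⟩)
      rwa [← ih r' hr' e]
  let M : TransClass.{u} :=
    { carrier := Set.range π
      transitive' := by
        rintro _ ⟨q, rfl⟩ y hy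
        obtain ⟨p, -, h⟩ := (hπ q y).1 hy
        exact ⟨p, h⟩ }
  let e : Ult U ≃ M := Equiv.ofInjective π hinj
  let E : setLang.Equiv (Ult U) M :=
    { e with
      map_fun' := fun f => nomatch f
      map_rel' := by
        rintro n r v
        cases r
        have hv : v = ![v 0, v 1] := by
          funext a
          fin_cases a <;> rfl
        rw [hv]
        change π (v 0) ∈ π (v 1) ↔ Ult.Mem U (v 0) (v 1)
        rw [hπ]
        exact ⟨fun ⟨p, hp, h⟩ => hinj h ▸ hp, fun h => ⟨_, h, rfl⟩⟩ }
  refine ⟨M, fun f => E (Ult.mk U f), E.surjective.comp Ult.mk_surjective, fun n φ f => ?_⟩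
  rw [← Ult.realize_mk]
  exact StrongHomClass.realize_formula E φ

end Ultrapower

/-! ### The Ketonen order -/

/-- The Ketonen order: `W` is below `U` if `W` is the `U`-limit of countably complete ultrafilters
`Z a` with `a ∈ Z a`. Ultrafilters on sets are represented by ultrafilters on the class of all
sets. -/
def KetonenLT (W U : Ultrafilter ZFSet.{u}) : Prop :=
  ∃ Z : ZFSet.{u} → Ultrafilter ZFSet.{u},
    (∀ᶠ a in U, CountableInterFilter (Z a : Filter ZFSet.{u}) ∧ ∀ᶠ x in Z a, x ∈ a) ∧
    ∀ A : Set ZFSet.{u}, A ∈ W ↔ ∀ᶠ a in U, A ∈ Z a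

/-- The Ketonen order on countably complete ultrafilters is well-founded. Given a descending
sequence `U n` with witnesses `Z n`, call `a` good to depth `0` at `n` if `Z n a` is countably
complete and contains `a`, and good to depth `m + 1` if moreover `Z n a`-almost all elements are good
to depth `m` at `n + 1`. Almost all elements are good to every depth, and below an element that is
good to every depth at `n` there is one that is good to every depth at `n + 1`. -/
theorem wellFounded_ketonenLT : WellFounded
    fun W U : {U : Ultrafilter ZFSet.{u} // CountableInterFilter (U : Filter ZFSet.{u})} =>
      KetonenLT W.1 U.1 := by
  rw [wellFounded_iff_isEmpty_descending_chain]
  refine ⟨fun ⟨U, hU⟩ => ?_⟩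
  choose Z hZ hlim using hU
  let good : ℕ → ℕ → Set ZFSet.{u} := fun m => m.rec
    (fun n => {a | CountableInterFilter (Z n a : Filter ZFSet.{u}) ∧ ∀ᶠ x in Z n a, x ∈ a})
    fun _ G n => {a | G (n + 1) ∈ Z n a}
  have hgood : ∀ m n, good m n ∈ (U n).1 := by
    intro m
    induction m with
    | zero => exact hZ
    | succ m ih => exact fun n => (hlim n _).1 (ih (n + 1))
  have hcc := fun n => (U n).2
  have step : ∀ n, ∀ a, (∀ m, a ∈ good m n) → ∃ b ∈ a, ∀ m, b ∈ good m (n + 1) := by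
    intro n a ha
    have h0 : CountableInterFilter (Z n a : Filter ZFSet.{u}) ∧ ∀ᶠ x in Z n a, x ∈ a := ha 0
    have := h0.1
    have h1 : ∀ᶠ b in Z n a, ∀ m, b ∈ good m (n + 1) :=
      eventually_countable_forall.2 fun m => ha (m + 1)
    obtain ⟨b, hb, hb'⟩ := (h0.2.and h1).exists
    exact ⟨b, hb, hb'⟩
  have := hcc 0
  obtain ⟨a₀, ha₀⟩ := (eventually_countable_forall.2 fun m => hgood m 0 :
    ∀ᶠ a in (U 0).1, ∀ m, a ∈ good m 0).exists
  choose g hg hg' using step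
  let s : ∀ n, {a // ∀ m, a ∈ good m n} := fun n =>
    Nat.rec (motive := fun n => {a // ∀ m, a ∈ good m n}) ⟨a₀, ha₀⟩
      (fun n a => ⟨g n a a.2, hg' n a a.2⟩) n
  exact (wellFounded_iff_isEmpty_descending_chain.1 ZFSet.mem_wf).false
    ⟨fun n => (s n).1, fun n => hg n (s n).1 (s n).2⟩

/-! ### Tail uniformity is first order -/

theorem fo_isFunc {α : Type*} (x y f : α) : FODef.{u} fun _ v =>
    ZFSet.IsFunc (v x : ZFSet.{u}) (v y) (v f) :=
  FODef.congr (P := fun N v => (∀ p : N, (p : ZFSet.{u}) ∈ (v f : ZFSet.{u}) →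
      ∃ a b : N, (a : ZFSet.{u}) ∈ (v x : ZFSet.{u}) ∧ (b : ZFSet.{u}) ∈ (v y : ZFSet.{u}) ∧
        (p : ZFSet.{u}) = ZFSet.pair (a : ZFSet.{u}) b) ∧
      ∀ z : N, (z : ZFSet.{u}) ∈ (v x : ZFSet.{u}) →
        ∃ w : N, ZFSet.pair (z : ZFSet.{u}) w ∈ (v f : ZFSet.{u}) ∧
          ∀ w' : N, ZFSet.pair (z : ZFSet.{u}) w' ∈ (v f : ZFSet.{u}) →
            (w' : ZFSet.{u}) = w)
    (.and (.all (.imp (fo_mem _ _) (.ex (.ex (.and (fo_mem _ _) (.and (fo_mem _ _)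
      (fo_pair _ _ _)))))))
      (.all (.imp (fo_mem _ _) (.ex (.and (fo_pair_mem _ _ _) (.all (.imp (fo_pair_mem _ _ _)
        (fo_eq _ _))))))))
    fun N v => by
      refine and_congr ⟨fun H p hp => ?_, fun H p hp => ?_⟩ ⟨fun H z hz => ?_, fun H z hz => ?_⟩
      · obtain ⟨a, b, ha, hb, h⟩ := H ⟨p, N.mem_of_mem (v f).2 hp⟩ hp
        exact ZFSet.mem_prod.2 ⟨a, ha, b, hb, h⟩
      · obtain ⟨a, ha, b, hb, h⟩ := ZFSet.mem_prod.1 (H hp)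
        exact ⟨⟨a, N.mem_of_mem (v x).2 ha⟩, ⟨b, N.mem_of_mem (v y).2 hb⟩, ha, hb, h⟩
      · obtain ⟨w, hw, h⟩ := H ⟨z, N.mem_of_mem (v x).2 hz⟩ hz
        exact ⟨w, hw, fun w' hw' => h ⟨w', (N.pair_mem (v f).2 hw').2⟩ hw'⟩
      · obtain ⟨w, hw, h⟩ := H z hz
        exact ⟨⟨w, (N.pair_mem (v f).2 hw).2⟩, hw, fun w' hw' => h _ hw'⟩

/-- The first-order content of `D` being a tail uniform countably complete ultrafilter on `α` in the
sense of `N`, with `w` standing for the set of natural numbers. Complements and intersections are only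
required to include an element of `D`, which is enough by `superset`. -/
structure UniformIn (N : TransClass.{u}) (α D w : N) : Prop where
  nonempty : ∀ A : N, (A : ZFSet.{u}) ∈ (D : ZFSet.{u}) → ¬ (A : ZFSet.{u}) = ∅
  top_mem : (α : ZFSet.{u}) ∈ (D : ZFSet.{u})
  superset : ∀ A B : N, (A : ZFSet.{u}) ∈ (D : ZFSet.{u}) → (A : ZFSet.{u}) ⊆ (B : ZFSet.{u}) →
    (B : ZFSet.{u}) ⊆ (α : ZFSet.{u}) → (B : ZFSet.{u}) ∈ (D : ZFSet.{u})
  ultra : ∀ A : N, (A : ZFSet.{u}) ⊆ (α : ZFSet.{u}) → (A : ZFSet.{u}) ∈ (D : ZFSet.{u}) ∨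
    ∃ C : N, (C : ZFSet.{u}) ∈ (D : ZFSet.{u}) ∧ ∀ x : N, (x : ZFSet.{u}) ∈ (C : ZFSet.{u}) →
      (x : ZFSet.{u}) ∈ (α : ZFSet.{u}) ∧ ¬ (x : ZFSet.{u}) ∈ (A : ZFSet.{u})
  tail : ∀ β : N, (β : ZFSet.{u}) ∈ (α : ZFSet.{u}) →
    ∃ C : N, (C : ZFSet.{u}) ∈ (D : ZFSet.{u}) ∧ ∀ x : N, (x : ZFSet.{u}) ∈ (C : ZFSet.{u}) →
      (x : ZFSet.{u}) ∈ (α : ZFSet.{u}) ∧ ¬ (x : ZFSet.{u}) ∈ (β : ZFSet.{u})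
  countable : ∀ f : N, ZFSet.IsFunc (w : ZFSet.{u}) D f →
    ∃ C : N, (C : ZFSet.{u}) ∈ (D : ZFSet.{u}) ∧ ∀ x : N, (x : ZFSet.{u}) ∈ (C : ZFSet.{u}) →
      (x : ZFSet.{u}) ∈ (α : ZFSet.{u}) ∧ ∀ n A : N,
        ZFSet.pair (n : ZFSet.{u}) A ∈ (f : ZFSet.{u}) → (x : ZFSet.{u}) ∈ (A : ZFSet.{u})

theorem fo_uniformIn {ι : Type*} (α D w : ι) : FODef.{u} fun N v =>
    UniformIn N (v α) (v D) (v w) := by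
  refine FODef.congr (P := fun N v =>
    (∀ A : N, (A : ZFSet.{u}) ∈ (v D : ZFSet.{u}) → ¬ (A : ZFSet.{u}) = ∅) ∧
    (v α : ZFSet.{u}) ∈ (v D : ZFSet.{u}) ∧
    (∀ A B : N, (A : ZFSet.{u}) ∈ (v D : ZFSet.{u}) → (A : ZFSet.{u}) ⊆ (B : ZFSet.{u}) →
      (B : ZFSet.{u}) ⊆ (v α : ZFSet.{u}) → (B : ZFSet.{u}) ∈ (v D : ZFSet.{u})) ∧
    (∀ A : N, (A : ZFSet.{u}) ⊆ (v α : ZFSet.{u}) → (A : ZFSet.{u}) ∈ (v D : ZFSet.{u}) ∨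
      ∃ C : N, (C : ZFSet.{u}) ∈ (v D : ZFSet.{u}) ∧
        ∀ x : N, (x : ZFSet.{u}) ∈ (C : ZFSet.{u}) →
          (x : ZFSet.{u}) ∈ (v α : ZFSet.{u}) ∧ ¬ (x : ZFSet.{u}) ∈ (A : ZFSet.{u})) ∧
    (∀ β : N, (β : ZFSet.{u}) ∈ (v α : ZFSet.{u}) →
      ∃ C : N, (C : ZFSet.{u}) ∈ (v D : ZFSet.{u}) ∧
        ∀ x : N, (x : ZFSet.{u}) ∈ (C : ZFSet.{u}) →
          (x : ZFSet.{u}) ∈ (v α : ZFSet.{u}) ∧ ¬ (x : ZFSet.{u}) ∈ (β : ZFSet.{u})) ∧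
    ∀ f : N, ZFSet.IsFunc (v w : ZFSet.{u}) (v D) f →
      ∃ C : N, (C : ZFSet.{u}) ∈ (v D : ZFSet.{u}) ∧
        ∀ x : N, (x : ZFSet.{u}) ∈ (C : ZFSet.{u}) →
          (x : ZFSet.{u}) ∈ (v α : ZFSet.{u}) ∧ ∀ n A : N,
            ZFSet.pair (n : ZFSet.{u}) A ∈ (f : ZFSet.{u}) → (x : ZFSet.{u}) ∈ (A : ZFSet.{u}))
    (.and (.all (.imp (fo_mem _ _) (.not (fo_empty _)))) <| .and (fo_mem _ _) <|
      .and (.all (.all (.imp (fo_mem _ _) (.imp (fo_subset _ _) (.imp (fo_subset _ _)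
        (fo_mem _ _)))))) <|
      .and (.all (.imp (fo_subset _ _) (.or (fo_mem _ _) (.ex (.and (fo_mem _ _)
        (.all (.imp (fo_mem _ _) (.and (fo_mem _ _) (.not (fo_mem _ _)))))))))) <|
      .and (.all (.imp (fo_mem _ _) (.ex (.and (fo_mem _ _)
        (.all (.imp (fo_mem _ _) (.and (fo_mem _ _) (.not (fo_mem _ _))))))))) <|
      .all (.imp (fo_isFunc _ _ _) (.ex (.and (fo_mem _ _)
        (.all (.imp (fo_mem _ _) (.and (fo_mem _ _)
          (.all (.all (.imp (fo_pair_mem _ _ _) (fo_mem _ _))))))))))) fun N v => ?_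
  exact ⟨fun ⟨a, b, c, d, e, f⟩ => ⟨a, b, c, d, e, f⟩, fun ⟨a, b, c, d, e, f⟩ => ⟨a, b, c, d, e, f⟩⟩

theorem IsUniformUltrafilterIn.uniformIn {N : TransClass.{u}} {α D w : N}
    (hw : (w : ZFSet.{u}) = ZFSet.omega) (h : IsUniformUltrafilterIn N α D) :
    UniformIn N α D w where
  nonempty A hA e := h.empty_notMem (e ▸ hA)
  top_mem := h.top_mem
  superset A B hA hAB hB := h.superset A hA B B.2 hAB hB
  ultra A hA := (h.ultra A A.2 hA).imp id fun hC =>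
    ⟨⟨_, N.mem_of_mem D.2 hC⟩, hC, fun _ hx => ZFSet.mem_sdiff.1 hx⟩
  tail β hβ := ⟨⟨_, N.mem_of_mem D.2 (h.tail β hβ)⟩, h.tail β hβ, fun _ hx => ZFSet.mem_sdiff.1 hx⟩
  countable f hf := by
    obtain ⟨S, hS, hSmem⟩ : ∃ S ∈ (D : ZFSet.{u}), ∀ x, x ∈ S ↔ x ∈ (α : ZFSet.{u}) ∧
        ∀ n A : ZFSet.{u}, ZFSet.pair n A ∈ (f : ZFSet.{u}) → x ∈ A :=
      ⟨_, h.countablyComplete f f.2 (hw ▸ hf), fun x => ZFSet.mem_sep⟩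
    exact ⟨⟨S, N.mem_of_mem D.2 hS⟩, hS, fun x hx =>
      ⟨((hSmem x).1 hx).1, fun n A => ((hSmem x).1 hx).2 n A⟩⟩

/-- A tail uniform countably complete ultrafilter in the sense of `V` induces a countably complete
ultrafilter on the class of all sets. -/
theorem UniformIn.exists_ultrafilter {α D w : V.{u}} (hw : (w : ZFSet.{u}) = ZFSet.omega)
    (h : UniformIn V α D w) : ∃ Z : Ultrafilter ZFSet.{u},
      CountableInterFilter (Z : Filter ZFSet.{u}) ∧ (∀ᶠ x in Z, x ∈ (α : ZFSet.{u})) ∧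
      ∀ β ∈ (α : ZFSet.{u}), ∀ᶠ x in Z, x ∉ β := by
  -- the classes whose trace on `α` is in `D`
  let F : Set (Set ZFSet.{u}) := {A | ZFSet.sep (· ∈ A) (α : ZFSet.{u}) ∈ (D : ZFSet.{u})}
  have hF : ∀ A : Set ZFSet.{u}, A ∈ F ↔ ∃ C ∈ (D : ZFSet.{u}), ∀ x ∈ C,
      x ∈ (α : ZFSet.{u}) ∧ x ∈ A := by
    intro A
    refine ⟨fun hA => ⟨_, hA, fun x hx => ZFSet.mem_sep.1 hx⟩, fun ⟨C, hC, hCA⟩ => ?_⟩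
    exact h.superset (inV C) (inV (ZFSet.sep (· ∈ A) (α : ZFSet.{u}))) hC
      (fun x hx => ZFSet.mem_sep.2 (hCA x hx)) ZFSet.sep_subset
  have hseq : ∀ s : ℕ → Set ZFSet.{u}, (∀ n, s n ∈ F) → ⋂ n, s n ∈ F := by
    intro s hs
    let f : ZFSet.{u} := ZFSet.range fun n : ℕ =>
      ZFSet.pair (n : Ordinal.{u}).toZFSet (ZFSet.sep (· ∈ s n) (α : ZFSet.{u}))
    have hf : ∀ n : ℕ,
        ZFSet.pair (n : Ordinal.{u}).toZFSet (ZFSet.sep (· ∈ s n) (α : ZFSet.{u})) ∈ f :=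
      fun n => ZFSet.mem_range.2 ⟨n, rfl⟩
    obtain ⟨C, hC, hCf⟩ := h.countable (inV f) (by
      rw [hw]
      refine ⟨fun p hp => ?_, fun z hz => ?_⟩
      · obtain ⟨n, rfl⟩ := ZFSet.mem_range.1 hp
        exact ZFSet.pair_mem_prod.2 ⟨mem_omega_iff.2 ⟨n, rfl⟩, hs n⟩
      · obtain ⟨n, rfl⟩ := mem_omega_iff.1 hz
        refine ⟨_, hf n, fun y hy => ?_⟩
        obtain ⟨m, hm⟩ := ZFSet.mem_range.1 hy
        obtain ⟨h1, h2⟩ := ZFSet.pair_inj.1 hm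
        have : m = n := by exact_mod_cast Ordinal.toZFSet_injective h1
        rw [← h2, this])
    refine (hF _).2 ⟨C, hC, fun x hx => ?_⟩
    obtain ⟨hxα, hx⟩ := hCf (inV x) hx
    exact ⟨hxα, Set.mem_iInter.2 fun n => (ZFSet.mem_sep.1 (hx (inV _) (inV _) (hf n))).2⟩
  have htop : Set.univ ∈ F := (hF _).2 ⟨α, h.top_mem, fun x hx => ⟨hx, trivial⟩⟩
  let G : Filter ZFSet.{u} := Filter.ofCountableInter F (fun S hS hSF => by
      rcases S.eq_empty_or_nonempty with rfl | hne
      · rwa [Set.sInter_empty]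
      · obtain ⟨s, rfl⟩ := hS.exists_eq_range hne
        rw [Set.sInter_range]
        exact hseq s fun n => hSF ⟨n, rfl⟩)
    (fun A B hA hAB => by
      obtain ⟨C, hC, hCA⟩ := (hF A).1 hA
      exact (hF B).2 ⟨C, hC, fun x hx => ⟨(hCA x hx).1, hAB (hCA x hx).2⟩⟩)
  have hG : ∀ A, A ∈ G ↔ A ∈ F := fun A => Iff.rfl
  have hcc : CountableInterFilter G := by unfold G; infer_instance
  have hempty : ∅ ∉ G := fun h0 => by
    obtain ⟨C, hC, hCA⟩ := (hF ∅).1 h0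
    exact h.nonempty (inV C) hC ((ZFSet.eq_empty C).2 fun x hx => (hCA x hx).2)
  refine ⟨Ultrafilter.ofComplNotMemIff G fun s => ⟨fun hs => ?_, fun hs hs' => ?_⟩, hcc,
    (hF _).2 ⟨α, h.top_mem, fun x hx => ⟨hx, hx⟩⟩, fun β hβ => ?_⟩
  · rcases h.ultra (inV (ZFSet.sep (· ∈ s) (α : ZFSet.{u}))) ZFSet.sep_subset with hA | ⟨C, hC, hCA⟩
    · exact hA
    · exact (hs ((hF _).2 ⟨C, hC, fun x hx => ⟨(hCA (inV x) hx).1, fun hxs =>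
        (hCA (inV x) hx).2 (ZFSet.mem_sep.2 ⟨(hCA (inV x) hx).1, hxs⟩)⟩⟩)).elim
  · have := inter_mem hs hs'
    rw [Set.inter_compl_self] at this
    exact hempty this
  · obtain ⟨C, hC, hCβ⟩ := h.tail (inV β) hβ
    exact (hF _).2 ⟨C, hC, fun x hx => hCβ (inV x) hx⟩

/-! ### Existence of Ketonen embeddings -/

/-- `U` is a countably complete ultrafilter on `δ + 1` that contains all tails of `δ`. The principal
ultrafilter at `δ` is included, and covers the case that `δ` is not tail uniform. -/
structure IsTailUltrafilter (δ : Cardinal.{u}) (U : Ultrafilter ZFSet.{u}) : Prop where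
  countable : CountableInterFilter (U : Filter ZFSet.{u})
  mem_succ : ∀ᶠ x in U, x ∈ (δ.ord + 1).toZFSet
  tail : ∀ a < δ.ord, ∀ᶠ x in U, x ∉ a.toZFSet

theorem isTailUltrafilter_pure (δ : Cardinal.{u}) :
    IsTailUltrafilter δ (pure δ.ord.toZFSet) where
  countable := by
    rw [Ultrafilter.coe_pure, ← Filter.principal_singleton]
    infer_instance
  mem_succ := by
    change δ.ord.toZFSet ∈ (δ.ord + 1).toZFSet
    exact Ordinal.toZFSet_mem_toZFSet_iff.2 (Order.lt_succ _)
  tail a ha := by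
    change δ.ord.toZFSet ∉ a.toZFSet
    rw [Ordinal.toZFSet_mem_toZFSet_iff]
    exact ha.asymm

/-- Ultrafilters that are minimal in the Ketonen order exist among those containing the tails. -/
theorem exists_minimal_tailUltrafilter (δ : Cardinal.{u}) :
    ∃ U : Ultrafilter ZFSet.{u}, IsTailUltrafilter δ U ∧
      ∀ W, IsTailUltrafilter δ W → ¬ KetonenLT W U := by
  obtain ⟨U, hU, hmin⟩ := wellFounded_ketonenLT.has_min {U | IsTailUltrafilter δ U.1}
    ⟨⟨_, (isTailUltrafilter_pure δ).countable⟩, isTailUltrafilter_pure δ⟩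
  exact ⟨U.1, hU, fun W hW => hmin ⟨W, hW.countable⟩ hW⟩

/-- The ultrapower by a minimal tail ultrafilter `U` on `δ + 1` is a Ketonen embedding. The element
`κ` represented by the identity is at least `δ_* = sup j[δ]`. If it were larger, the ultrafilter
derived from `δ_*` would be below `U`; and a tail uniform ultrafilter on `δ_*` in the ultrapower,
represented by a sequence of ultrafilters, would have as its limit an ultrafilter below `U`. -/
theorem exists_isKetonen {δ : Cardinal.{u}} (hδ : δ.IsRegular) :
    ∃ (M : TransClass.{u}) (j : Emb V M), IsKetonen j δ := by
  obtain ⟨U, hU, hmin⟩ := exists_minimal_tailUltrafilter δ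
  have := hU.countable
  obtain ⟨M, c, hc, hreal⟩ := exists_ultrapower hU.mem_succ
  have los : ∀ {n : ℕ} {P : ∀ N : TransClass.{u}, (Fin n → N) → Prop}, FODef P →
      ∀ f : Fin n → ZFSet.{u} → V.{u},
        P M (fun i => c (f i)) ↔ ∀ᶠ x in U, P V fun i => f i x := by
    rintro n P ⟨φ, hφ⟩ f
    rw [← hφ, hreal]
    simp only [hφ]
  let j : Emb V M := ⟨fun a => c fun _ => a, fun n φ x =>
    (hreal n φ fun i _ => x i).trans eventually_const⟩
  have hj : ∀ a, c (fun _ => a) = j a := fun a => rfl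
  let κ : M := c inV
  have hord : ∀ᶠ x : ZFSet.{u} in U, x.IsOrdinal := hU.mem_succ.mono fun x hx =>
    (ZFSet.isOrdinal_toZFSet _).mem hx
  have hκ : (κ : ZFSet.{u}).IsOrdinal := (los (fo_ordinal (0 : Fin 1)) ![inV]).2 hord
  have hle : supImage j δ ⊆ κ := by
    intro y hy
    obtain ⟨a, ha, hy⟩ := mem_supImage.1 hy
    refine (los (fo_subset (0 : Fin 2) 1) ![fun _ => inV a.toZFSet, inV]).2 ?_ hy
    filter_upwards [hord, hU.tail a ha] with x hx hxa
    exact (hx.notMem_iff_subset (ZFSet.isOrdinal_toZFSet a)).1 hxa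
  have hκe : supImage j δ = κ := by
    refine (((isOrdinal_supImage j δ).subset_iff_eq_or_mem hκ).1 hle).resolve_right fun hlt => ?_
    obtain ⟨f, hf⟩ := hc (supImageIn j δ)
    have hfx : ∀ᶠ x in U, (f x : ZFSet.{u}) ∈ x := by
      refine (los (fo_mem (0 : Fin 2) 1) ![f, inV]).1 ?_
      change (c f : ZFSet.{u}) ∈ (κ : ZFSet.{u})
      rw [hf]
      exact hlt
    -- the ultrafilter derived from `δ_*` is a limit of principal ultrafilters
    refine hmin (U.map fun x => (f x : ZFSet.{u})) ⟨?_, ?_, fun a ha => ?_⟩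
      ⟨fun x => pure (f x : ZFSet.{u}), ?_, fun A => Iff.rfl⟩
    · rw [Ultrafilter.coe_map]
      infer_instance
    · refine Ultrafilter.mem_map.2 ?_
      filter_upwards [hU.mem_succ, hfx] with x hx hfx
      exact (ZFSet.isOrdinal_toZFSet _).mem_trans hfx hx
    · refine Ultrafilter.mem_map.2 ?_
      refine (los (fo_mem (0 : Fin 2) 1).not ![f, fun _ => inV a.toZFSet]).1 ?_
      change ¬ (c f : ZFSet.{u}) ∈ (j (inV a.toZFSet) : ZFSet.{u})
      rw [hf]
      exact ZFSet.mem_asymm (emb_mem_supImage hδ j ha)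
    · filter_upwards [hfx] with x hx
      refine ⟨?_, hx⟩
      rw [Ultrafilter.coe_pure, ← Filter.principal_singleton]
      infer_instance
  refine ⟨M, j, ?_, ?_⟩
  · -- every element is the value at `κ` of the image of a function on `δ + 1`
    rw [hκe]
    refine Set.eq_univ_of_forall fun y => ?_
    obtain ⟨f, rfl⟩ := hc y
    obtain ⟨d, hd⟩ : ∃ d : ZFSet.{u}, ∀ᶠ x in U, x ∈ d := ⟨_, hU.mem_succ⟩
    let F : V.{u} := inV (ZFSet.range fun x : {x // x ∈ d} => ZFSet.pair x (f x))
    have hF1 : ZFSet.pair (κ : ZFSet.{u}) (c f) ∈ (j F : ZFSet.{u}) := by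
      refine (los (fo_pair_mem (0 : Fin 3) 1 2) ![inV, f, fun _ => F]).2 ?_
      filter_upwards [hd] with x hx
      exact ZFSet.mem_range.2 ⟨⟨x, hx⟩, rfl⟩
    have hF2 := (emb_singleValued j (f := F)).2 fun a b b' h h' => by
      obtain ⟨x, hx⟩ := ZFSet.mem_range.1 h
      obtain ⟨x', hx'⟩ := ZFSet.mem_range.1 h'
      obtain ⟨e1, e2⟩ := ZFSet.pair_inj.1 hx
      obtain ⟨e1', e2'⟩ := ZFSet.pair_inj.1 hx'
      rw [← e2, ← e2', e1, e1']
    refine mem_hull_of_foDef (α := Fin 2)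
      (P := fun N v z => ZFSet.pair (v 0 : ZFSet.{u}) z ∈ (v 1 : ZFSet.{u}))
      (fo_pair_mem _ _ _) ![κ, j F] (fun a => ?_) fun z => ⟨fun h => ?_, fun h => h ▸ hF1⟩
    · fin_cases a
      exacts [Or.inr rfl, Or.inl ⟨F, rfl⟩]
    · exact Subtype.ext (hF2 κ z (c f) h hF1)
  · rintro ⟨D, hD⟩
    obtain ⟨D, rfl⟩ : ∃ D' : M, (D' : ZFSet.{u}) = D := ⟨⟨D, hD.mem_model⟩, rfl⟩
    obtain ⟨f, rfl⟩ := hc D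
    rw [hκe] at hD
    have hunif : ∀ᶠ x in U, UniformIn V (inV x) (f x) (inV ZFSet.omega) :=
      (los (fo_uniformIn (0 : Fin 3) 1 2) ![inV, f, fun _ => inV ZFSet.omega]).1
        (hD.uniformIn (w := j (inV ZFSet.omega)) (emb_omega j rfl))
    have hZ : ∀ x, ∃ Z : Ultrafilter ZFSet.{u}, UniformIn V (inV x) (f x) (inV ZFSet.omega) →
        CountableInterFilter (Z : Filter ZFSet.{u}) ∧ (∀ᶠ z in Z, z ∈ x) ∧
          ∀ β ∈ x, ∀ᶠ z in Z, z ∉ β := by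
      intro x
      by_cases h : UniformIn V (inV x) (f x) (inV ZFSet.omega)
      · obtain ⟨Z, hZ⟩ := h.exists_ultrafilter rfl
        exact ⟨Z, fun _ => hZ⟩
      · exact ⟨pure ∅, fun h' => (h h').elim⟩
    choose Z hZ using hZ
    have hmem : ∀ A : Set ZFSet.{u}, A ∈ U.bind Z ↔ ∀ᶠ x in U, A ∈ Z x := fun A => Iff.rfl
    refine hmin (U.bind Z) ⟨⟨fun S hS hSU => ?_⟩, ?_, fun a ha => ?_⟩
      ⟨Z, hunif.mono fun x hx => ⟨(hZ x hx).1, (hZ x hx).2.1⟩, hmem⟩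
    · refine (hmem _).2 ?_
      filter_upwards [(eventually_countable_ball hS).2 fun A hA => (hmem A).1 (hSU A hA), hunif]
        with x hx hxu
      have := (hZ x hxu).1
      exact (countable_sInter_mem hS).2 hx
    · refine (hmem _).2 ?_
      filter_upwards [hU.mem_succ, hunif] with x hx hxu
      filter_upwards [(hZ x hxu).2.1] with z hz
      exact (ZFSet.isOrdinal_toZFSet _).mem_trans hz hx
    · refine (hmem _).2 ?_
      have hlt : ∀ᶠ x : ZFSet.{u} in U, a.toZFSet ∈ x := by
        refine (los (fo_mem (0 : Fin 2) 1) ![fun _ => inV a.toZFSet, inV]).1 ?_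
        change (j (inV a.toZFSet) : ZFSet.{u}) ∈ (κ : ZFSet.{u})
        rw [← hκe]
        exact emb_mem_supImage hδ j ha
      filter_upwards [hlt, hunif] with x hx hxu
      exact (hZ x hxu).2.2 _ hx

end UltraAx

theorem mainTheorem10 (UA : UltraAx.UltrapowerAxiom.{u})
    (δ : Cardinal.{u}) (hδ : δ.IsRegular) :
    (∀ (M M' : UltraAx.TransClass.{u}) (j : UltraAx.Emb UltraAx.V M)
        (j' : UltraAx.Emb UltraAx.V M'),
      UltraAx.IsKetonen j δ → UltraAx.IsZeroOrder j' δ →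
        ∃ k : UltraAx.Emb M M', UltraAx.IsInternalUltrapower k ∧ j' = k.comp j) ∧
    ∃! p : (M : UltraAx.TransClass.{u}) × UltraAx.Emb UltraAx.V M, UltraAx.IsKetonen p.2 δ := by
  refine ⟨fun M M' j j' hj hj' => ?_, ?_⟩
  · obtain ⟨k, hk, hkj, -⟩ := hj.exists_factor UA hδ hj'
    exact ⟨k, hk, hkj⟩
  · obtain ⟨M, j, hj⟩ := UltraAx.exists_isKetonen hδ
    exact ⟨⟨M, j⟩, hj, fun q hq => UltraAx.IsKetonen.unique UA hδ hq hj⟩
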